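/- Let $D_1,\dots,D_m\subset\mathbb C$ be pairwise disjoint closed disks, $\gamma_j=\partial D_j$, $\gamma=\bigcup_j\gamma_j$, $\mathbf D^{\rm int}=\bigcup_j D_j$, $\mathbf D^{\rm ext}=\mathbf P^1\setminus\mathbf D^{\rm int}$. A function $f$ holomorphic near $\gamma$ is written uniquely as $f=f_++f_-$ near $\gamma$, with $f_+$ analytic on $\mathbf D^{\rm int}$ and $f_-$ analytic on $\mathbf D^{\rm ext}$ up to the boundary, $f_-(\infty)=0$; $\mathbf 1_{\gamma_k}$ is the function equal to $1$ near $\gamma_k$ and $0$ near the other $\gamma_j$. Let $\mathcal M$ be the space of pairs $\vec a=(a,\hat a)$ of functions without zeros, where $a$ is analytic on $\mathbf D^{\rm ext}\setminus\{\infty\}$ up to the boundary with $a(z)=z+O(z^{-1})$ at $\infty$, $\hat a$ is analytic on $\mathbf D^{\rm int}$ except for one simple pole $\varphi_j$ in the interior of each $D_j$, and $\zeta:=a-\hat a$ satisfies $\zeta'\neq0$ on $\gamma$. Put $\ell=a_++\hat a_-$. A tangent vector $X$ at $\vec a$ is a pair $(\partial_Xa,\partial_X\hat a)$ with $\partial_Xa$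 analytic on $\mathbf D^{\rm ext}$ up to the boundary and vanishing at $\infty$, and $\partial_X\hat a$ analytic on $\mathbf D^{\rm int}$ except for poles of order at most $2$ at the $\varphi_j$; put $\partial_X\zeta=\partial_Xa-\partial_X\hat a$ and $\partial_X\ell=(\partial_Xa)_++(\partial_X\hat a)_-$. The derivative of a function on $\mathcal M$ in the direction $X$ is its derivative along curves in $\mathcal M$ with velocity $X$ (uniformly on $\gamma$). The metric is $$\langle X,Y\rangle_\eta=-\frac1{2\pi i}\sum_{j}\oint_{\gamma_j}\frac{\partial_X\zeta\,\partial_Y\zeta}{\zeta'}dz-\Big(\operatorname*{Res}_{z=\infty}+\sum_j\operatorname*{Res}_{z=\varphi_j}\Big)\frac{\partial_X\ell\,\partial_Y\ell}{\ell'}dz .$$ Consider the flat vector fields $$\frac{\partial\vec a}{\partial h_{k,0}}=\big(-(\ell'\mathbf 1_{\gamma_k})_-,\,-(\ell'\mathbf 1_{\gamma_k})_-\big),\qquad \frac{\partial\vec a}{\partial t_{k,0}}=\big(-(\zeta'\mathbf 1_{\gamma_k})_-,\,(\zeta'\mathbf 1_{\gamma_k})_+\big),\qquad e=\sum_{k=1}^m\Big(\frac{\partial}{\partial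 t_{k,0}}+\frac{\partial}{\partial h_{k,0}}\Big),$$ and the Hamiltonian densities of the principal hierarchy, for $p\ge0$, $$\theta_{h_{k,0},p}=\frac1{(p+1)!}\operatorname*{Res}_{z=\varphi_k}\hat a^{p+1}dz,\qquad \theta_{e,p}=\sum_{k=1}^m\Big(\theta_{h_{k,0},p}+\frac1{(p+1)!}\frac1{2\pi i}\oint_{\gamma_k}(a^{p+1}-\hat a^{p+1})dz\Big).$$ Put $Q_{e,p}=a^{p+1}\sum_k\mathbf 1_{\gamma_k}$, $Q_{h_{k,0},p}=\hat a^{p+1}\mathbf 1_{\gamma_k}$, and define $$\Omega_{\alpha,p;\beta,q}=\frac1{(1+p)!(1+q)!}\frac1{2\pi i}\oint_\gamma(Q_{\alpha,p})_-\,dQ_{\beta,q},\quad \alpha,\beta\in\{h_{k,0}\}_{k=1}^m,$$ $$\Omega_{e,p;\beta,q}=-\frac1{(1+p)!(1+q)!}\frac1{2\pi i}\oint_\gamma(Q_{e,p})_+\,dQ_{\beta,q},\quad \beta\in\{h_{k,0}\}_{k=1}^m\cup\{e\},$$ and $\Omega_{h_{k,0},p;e,q}=\Omega_{e,q;h_{k,0},p}$.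 Theorem. These functions constitute the $\tau$-structure of the principal hierarchy over the sector $\{h_{k,0}\}_{k=1}^m\cup\{e\}$. That is, for all $\alpha,\beta$ in the sector and $p,q\ge0$, at every point of $\mathcal M$: the densities $\theta_{\alpha,p}$ have gradients with respect to $\langle\cdot,\cdot\rangle_\eta$, and $$\Omega_{\alpha,p-1;\beta,q}+\Omega_{\alpha,p;\beta,q-1}=\langle\operatorname{grad}\theta_{\alpha,p},\operatorname{grad}\theta_{\beta,q}\rangle_\eta$$ (components with an index $-1$ being zero), with symmetry and boundary conditions $$\Omega_{\alpha,p;\beta,q}=\Omega_{\beta,q;\alpha,p},\qquad \Omega_{\alpha,p;e,0}=\theta_{\alpha,p},\qquad \Omega_{\alpha,0;\beta,q}=\partial_\alpha\theta_{\beta,q+1},$$ where $\partial_\alpha$ is the derivative along the flat field $\partial/\partial h_{k,0}$ or $e$. -/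

import Mathlib

open Filter Topology

noncomputable section

namespace Whitham

/-- Pairwise disjoint closed disks `D_j = closedBall (center j) (radius j)`, `j : Fin m`. -/
structure DiskConfig (m : ℕ) where
  center : Fin m → ℂ
  radius : Fin m → ℝ
  radius_pos : ∀ j, 0 < radius j
  disjoint : ∀ i j, i ≠ j →
    Disjoint (Metric.closedBall (center i) (radius i)) (Metric.closedBall (center j) (radius j))

variable {m : ℕ}

namespace DiskConfig

variable (D : DiskConfig m)

/-- `D^int`, the union of the closed disks. -/
def interiorDomain : Set ℂ := ⋃ j, Metric.closedBall (D.center j) (D.radius j)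

/-- The finite part of `D^ext` together with its boundary `γ`. -/
def exteriorDomain : Set ℂ := (⋃ j, Metric.ball (D.center j) (D.radius j))ᶜ

/-- `γ`, the union of the boundary circles `γ_j = ∂D_j`. -/
def contour : Set ℂ := ⋃ j, Metric.sphere (D.center j) (D.radius j)

/-- `(1 / 2πi) ∮_{γ_j} f dz`. -/
def contourInt (j : Fin m) (f : ℂ → ℂ) : ℂ :=
  (2 * Real.pi * Complex.I)⁻¹ * ∮ z in C(D.center j, D.radius j), f z

/-- `(1 / 2πi) ∮_γ f dz`. -/
def totalInt (f : ℂ → ℂ) : ℂ := ∑ j, D.contourInt j f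

/-- An open set that contains `D_k` and is disjoint from the other disks. -/
def cell (k : Fin m) : Set ℂ :=
  {z | ∀ j, j ≠ k → dist z (D.center k) - D.radius k < dist z (D.center j) - D.radius j}

/-- The characteristic function `1_{γ_k}`, as a function that is locally constant near `γ`:
it is `1` near `D_k` and `0` near the other disks. -/
def charFun (k : Fin m) : ℂ → ℂ := (D.cell k).indicator 1

/-- `f = fp + fm` near `γ`, with `fp` analytic on `D^int` and `fm` analytic on `D^ext` (up to the
boundary) and vanishing at infinity. -/
def IsSplitting (f fp fm : ℂ → ℂ) : Prop :=
  AnalyticOnNhd ℂ fp D.interiorDomain ∧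
  AnalyticOnNhd ℂ fm D.exteriorDomain ∧
  Tendsto fm (cocompact ℂ) (𝓝 0) ∧
  ∀ᶠ z in 𝓝ˢ D.contour, f z = fp z + fm z

open Classical in
/-- A choice of the two functions of the splitting of `f` (they are unique on `D^int` and on `D^ext`
respectively); `0` if there is no splitting. -/
def splitting (f : ℂ → ℂ) : (ℂ → ℂ) × (ℂ → ℂ) :=
  if h : ∃ g : (ℂ → ℂ) × (ℂ → ℂ), D.IsSplitting f g.1 g.2 then h.choose else 0

open Classical in
/-- `f_+`. Outside `D^int` it is continued by `f - f_-`, wherever `f` is defined. -/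
def plusPart (f : ℂ → ℂ) (z : ℂ) : ℂ :=
  if z ∈ D.interiorDomain then (D.splitting f).1 z else f z - (D.splitting f).2 z

open Classical in
/-- `f_-`. Inside `D^int` it is continued by `f - f_+`, wherever `f` is defined. -/
def minusPart (f : ℂ → ℂ) (z : ℂ) : ℂ :=
  if z ∈ D.interiorDomain then f z - (D.splitting f).1 z else (D.splitting f).2 z

end DiskConfig

/-- The residue of `f dz` at an isolated singularity `w`. -/
def residue (f : ℂ → ℂ) (w : ℂ) : ℂ :=
  limUnder (𝓝[>] (0 : ℝ)) fun ρ : ℝ => (2 * Real.pi * Complex.I)⁻¹ * ∮ z in C(w, ρ), f z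

/-- The residue of `f dz` at `∞`. -/
def residueInfty (f : ℂ → ℂ) : ℂ :=
  limUnder atTop fun R : ℝ => -((2 * Real.pi * Complex.I)⁻¹ * ∮ z in C((0 : ℂ), R), f z)

/-- A point `(a, â)` of the manifold `𝓜`. The functions are analytic up to the boundary `γ`; only
their values on the respective domain (and, by continuation, near `γ`) matter. The last condition is
what the metric needs. -/
structure Point (D : DiskConfig m) where
  a : ℂ → ℂ
  aHat : ℂ → ℂ
  φ : Fin m → ℂ
  φ_mem : ∀ j, φ j ∈ Metric.ball (D.center j) (D.radius j)
  a_analytic : AnalyticOnNhd ℂ a D.exteriorDomain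
  /-- `a(z) = z + a₁ z⁻¹ + a₂ z⁻² + ⋯` at infinity. -/
  a_infty : Tendsto (fun z => a z - z) (cocompact ℂ) (𝓝 0)
  aHat_analytic : AnalyticOnNhd ℂ aHat (D.interiorDomain \ Set.range φ)
  /-- `â` has a simple pole at each `φ_j`. -/
  aHat_pole : ∀ j, meromorphicOrderAt aHat (φ j) = -1
  a_ne_zero : ∀ z ∈ D.exteriorDomain, a z ≠ 0
  aHat_ne_zero : ∀ z ∈ D.interiorDomain \ Set.range φ, aHat z ≠ 0
  zeta_deriv_ne_zero : ∀ z ∈ D.contour, deriv (fun w => a w - aHat w) z ≠ 0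

variable {D : DiskConfig m}

namespace Point

/-- `ζ = a - â`. -/
def zeta (P : Point D) (z : ℂ) : ℂ := P.a z - P.aHat z

/-- `ℓ = a_+ + â_-`. -/
def ell (P : Point D) (z : ℂ) : ℂ := D.plusPart P.a z + D.minusPart P.aHat z

/-- `X = (∂_X a, ∂_X â)` is a tangent vector of `𝓜` at `P`. -/
def IsTangent (P : Point D) (X : (ℂ → ℂ) × (ℂ → ℂ)) : Prop :=
  AnalyticOnNhd ℂ X.1 D.exteriorDomain ∧
  Tendsto X.1 (cocompact ℂ) (𝓝 0) ∧
  AnalyticOnNhd ℂ X.2 (D.interiorDomain \ Set.range P.φ) ∧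
  ∀ j, MeromorphicAt X.2 (P.φ j) ∧ -2 ≤ meromorphicOrderAt X.2 (P.φ j)

/-- `∂_X ζ`. -/
def dZeta (X : (ℂ → ℂ) × (ℂ → ℂ)) (z : ℂ) : ℂ := X.1 z - X.2 z

/-- `∂_X ℓ`. -/
def dEll (D : DiskConfig m) (X : (ℂ → ℂ) × (ℂ → ℂ)) (z : ℂ) : ℂ :=
  D.plusPart X.1 z + D.minusPart X.2 z

/-- The flat metric `⟨X, Y⟩_η` at `P`. -/
def metric (P : Point D) (X Y : (ℂ → ℂ) × (ℂ → ℂ)) : ℂ :=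
  -D.totalInt (fun z => dZeta X z * dZeta Y z / deriv P.zeta z)
    - (residueInfty (fun z => dEll D X z * dEll D Y z / deriv P.ell z)
      + ∑ j, residue (fun z => dEll D X z * dEll D Y z / deriv P.ell z) (P.φ j))

/-- The flat vector field `∂/∂h_{k,0}`. -/
def flatH (P : Point D) (k : Fin m) : (ℂ → ℂ) × (ℂ → ℂ) :=
  (-D.minusPart (fun z => deriv P.ell z * D.charFun k z),
    -D.minusPart (fun z => deriv P.ell z * D.charFun k z))

/-- The flat vector field `∂/∂t_{k,0}`. -/
def flatT (P : Point D) (k : Fin m) : (ℂ → ℂ) × (ℂ → ℂ) :=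
  (-D.minusPart (fun z => deriv P.zeta z * D.charFun k z),
    D.plusPart (fun z => deriv P.zeta z * D.charFun k z))

/-- The unit vector field `e = ∑_k (∂/∂t_{k,0} + ∂/∂h_{k,0})`. -/
def unitField (P : Point D) : (ℂ → ℂ) × (ℂ → ℂ) := ∑ k, (P.flatT k + P.flatH k)

/-- The Hamiltonian density `θ_{h_{k,0},p}`. -/
def thetaH (k : Fin m) (p : ℕ) (P : Point D) : ℂ :=
  ((p + 1).factorial : ℂ)⁻¹ * residue (fun z => P.aHat z ^ (p + 1)) (P.φ k)

/-- The Hamiltonian density `θ_{t_{k,0},p}`. -/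
def thetaT (k : Fin m) (p : ℕ) (P : Point D) : ℂ :=
  ((p + 1).factorial : ℂ)⁻¹ * D.contourInt k (fun z => P.a z ^ (p + 1) - P.aHat z ^ (p + 1))

end Point

/-- A (complex) curve `s ↦ c s` in `𝓜` has velocity `X = (∂_s a, ∂_s â)` at `s = 0`, uniformly on
`γ`. -/
def HasVelocity (c : ℂ → Point D) (X : (ℂ → ℂ) × (ℂ → ℂ)) : Prop :=
  TendstoUniformlyOn (fun s z => ((c s).a z - (c 0).a z) / s) X.1 (𝓝[≠] (0 : ℂ)) D.contour ∧
  TendstoUniformlyOn (fun s z => ((c s).aHat z - (c 0).aHat z) / s) X.2 (𝓝[≠] (0 : ℂ)) D.contour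

/-- The function `F` on `𝓜` has derivative `d` at `P` in the direction `X`: there are curves in `𝓜`
through `P` with velocity `X`, and `F` has derivative `d` along each of them. -/
def HasDirDeriv (F : Point D → ℂ) (P : Point D) (X : (ℂ → ℂ) × (ℂ → ℂ)) (d : ℂ) : Prop :=
  (∃ c : ℂ → Point D, c 0 = P ∧ HasVelocity c X) ∧
  ∀ c : ℂ → Point D, c 0 = P → HasVelocity c X → HasDerivAt (fun s => F (c s)) d 0

/-- `Y` is the gradient of `F` at `P` with respect to the flat metric. -/
def IsGradient (F : Point D → ℂ) (P : Point D) (Y : (ℂ → ℂ) × (ℂ → ℂ)) : Prop :=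
  P.IsTangent Y ∧ ∀ X, P.IsTangent X → HasDirDeriv F P X (P.metric Y X)

/-- The sector `{h_{k,0}} ∪ {e}`. -/
inductive Sector (m : ℕ) where
  | h (k : Fin m)
  | e

/-- The Hamiltonian densities of the sector. -/
def theta : Sector m → ℕ → Point D → ℂ
  | .h k, p, P => P.thetaH k p
  | .e, p, P => ∑ k, (P.thetaT k p + P.thetaH k p)

/-- The flat vector fields of the sector. -/
def flatField (P : Point D) : Sector m → (ℂ → ℂ) × (ℂ → ℂ)
  | .h k => P.flatH k
  | .e => P.unitField

/-- `Q_{α,p}`. -/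
def Q (P : Point D) : Sector m → ℕ → ℂ → ℂ
  | .h k, p => fun z => P.aHat z ^ (p + 1) * D.charFun k z
  | .e, p => fun z => P.a z ^ (p + 1) * ∑ k, D.charFun k z

/-- The contour integrals `Ω_{α,p;β,q}`. The component with first index `h_{k,0}` and second index
`e` is the one with the two pairs of indices exchanged. -/
def Omega : Sector m → ℕ → Sector m → ℕ → Point D → ℂ
  | .h k, p, .h l, q, P =>
      (((1 + p).factorial : ℂ) * ((1 + q).factorial : ℂ))⁻¹ *
        D.totalInt (fun z => D.minusPart (Q P (.h k) p) z * deriv (Q P (.h l) q) z)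
  | .e, p, β, q, P =>
      -((((1 + p).factorial : ℂ) * ((1 + q).factorial : ℂ))⁻¹ *
        D.totalInt (fun z => D.plusPart (Q P .e p) z * deriv (Q P β q) z))
  | .h k, p, .e, q, P =>
      -((((1 + q).factorial : ℂ) * ((1 + p).factorial : ℂ))⁻¹ *
        D.totalInt (fun z => D.plusPart (Q P .e q) z * deriv (Q P (.h k) p) z))

/-- `W` is a `τ`-structure, over the sector `{h_{k,0}} ∪ {e}`, for the hierarchy with Hamiltonian
densities `Θ`. In the recursion, `∑ η^{μν} ∂_μ Θ_{α,p} ∂_ν Θ_{β,q}` is the metric product of the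
gradients, and components with an index `-1` are zero. -/
structure IsTauStructure (Θ : Sector m → ℕ → Point D → ℂ)
    (W : Sector m → ℕ → Sector m → ℕ → Point D → ℂ) : Prop where
  exists_gradient : ∀ α p P, ∃ Y, IsGradient (Θ α p) P Y
  recursion : ∀ α p β q P Y Z, IsGradient (Θ α p) P Y → IsGradient (Θ β q) P Z →
    (if p = 0 then 0 else W α (p - 1) β q P) + (if q = 0 then 0 else W α p β (q - 1) P)
      = P.metric Y Z
  symm : ∀ α p β q P, W α p β q P = W β q α p P
  unit : ∀ α p P, W α p .e 0 P = Θ α p P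
  initial : ∀ α β q P, HasDirDeriv (Θ β (q + 1)) P (flatField P α) (W α 0 β q P)

end Whitham

end

/-! Let `b` be `â` for the index `h_{k,0}` and `a` for the index `e`, let `χ` be the matching
locally constant factor (`1_{γ_k}` or `∑ 1_{γ_k}`), and put `f_{α,p} = b^p χ / p!` (`density`).
Write `∮` for the normalised integral over `γ`. Then `θ_{α,p} = ∮ f_{α,p+1}`, `Q_{α,p} = (1+p)!
f_{α,p+1}`, and near `γ` one has `f_{α,p+1}' = f_{α,p} b'` and `f_{α,0}' = 0`. So each `Ω` is, up to
sign, the integral of a projection of `f_{α,p+1}` against `d f_{β,q+1}`, and the convention for an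
index `-1` holds automatically.

Everything else is a computation of contour integrals modulo four kinds of vanishing ones: functions
analytic on `D^int`, functions analytic on `D^ext` that are `o(1/z)` at infinity, derivatives, and
products `f_{α,p} f_{β,q} b'` with the same `b` (which are derivatives too). In particular `∮ f_+
g_+ = ∮ f_- g_- = 0`, so the two projections are adjoint to each other.

Gradients. The derivative of `θ_{α,p}` along `X` is `∮ f_{α,p} ∂_X b` (`hasDerivAt_theta_curve`). If
`Y` has `∂_Y ζ = u ζ'` and `∂_Y ℓ = (V ℓ')_-`, the metric reduces to `⟨Y, X⟩ = ∮ (-u ∂_X a + (u - V)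
∂_X â)` (`metric_gradVec`). With `f = f_{α,p}`, the choice `u = f_-`, `V = -f_+` for `h_{k,0}` and
`u = V = -f_+` for `e` gives the gradient, because `∮ f_- ∂_X a = 0`.

Recursion. The product of two gradients is the derivative of one density along the explicit gradient
of the other. In it `ζ' = a' - â'`, and `ℓ'` equals `â'` up to a function analytic on `D^int`;
adjointness and integration by parts then turn it into the sum of two `Ω`'s (`shiftedOmega_add_h_h`,
`shiftedOmega_add_e_h`, `shiftedOmega_add_e_e`).

Boundary conditions. Since `a_+ = z`, `Ω_{e,0;β,q} = -∮ z f_{β,q+1}' = θ_{β,q}`. The field `e` acts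
by `∂_e b = 1 - b'`, and `∂/∂h_{k,0}` changes both `a` and `â` by `-((â 1_{γ_k})_-)'`.

For directional derivatives to be determined, every tangent vector must be the velocity of a curve
in the manifold; `exists_deformation` supplies one. -/

namespace Whitham

open Metric Set

/-! ### Cauchy integrals over circles and the Laurent decomposition -/

/-- A circle integral depends continuously on a parameter. -/
theorem tendsto_circleIntegral_of_continuousOn_prod {F : ℂ → ℂ → ℂ} {s : Set ℂ} {x c : ℂ} {R : ℝ}
    (hR : 0 ≤ R) (hs : s ∈ 𝓝 x) (hF : ContinuousOn (Function.uncurry F) (s ×ˢ sphere c R)) :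
    Tendsto (fun y => ∮ z in C(c, R), F y z) (𝓝 x) (𝓝 (∮ z in C(c, R), F x z)) := by
  refine TendstoUniformlyOn.tendsto_circleIntegral_of_continuousOn hR ?_ ?_
  · filter_upwards [hs] with y hy
    exact hF.comp (by fun_prop : ContinuousOn (fun z : ℂ => (y, z)) _) fun z hz => ⟨hy, hz⟩
  · intro u hu
    obtain ⟨v, hv, h⟩ := (isCompact_sphere c R).mem_uniformity_of_prod hF (mem_of_mem_nhds hs)
      (symm_le_uniformity hu)
    rw [nhdsWithin_eq_nhds.2 hs] at hv
    filter_upwards [hv] with y hy z hz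
    exact h y hy z hz

/-- The Cauchy integral `(2πi)⁻¹ ∮ f(w) / (w - z) dw`. -/
noncomputable def cauchyTransform (f : ℂ → ℂ) (c : ℂ) (R : ℝ) (z : ℂ) : ℂ :=
  (2 * Real.pi * Complex.I)⁻¹ * ∮ w in C(c, R), (w - z)⁻¹ * f w

/-- The difference quotient of the kernel `(w - z)⁻¹` is `(w - y)⁻¹ (w - z)⁻¹`, so the slope is
again a circle integral, and it depends continuously on `y`. -/
theorem differentiableAt_cauchyTransform {f : ℂ → ℂ} {c z : ℂ} {R : ℝ} (hR : 0 ≤ R)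
    (hf : ContinuousOn f (sphere c R)) (hz : z ∉ sphere c R) :
    DifferentiableAt ℂ (cauchyTransform f c R) z := by
  refine DifferentiableAt.const_mul ?_ _
  have hU : (sphere c R)ᶜ ∈ 𝓝 z := isClosed_sphere.isOpen_compl.mem_nhds hz
  have hne : ∀ y ∉ sphere c R, ∀ w ∈ sphere c R, w - y ≠ 0 := by
    intro y hy w hw h
    exact hy (sub_eq_zero.1 h ▸ hw)
  refine HasDerivAt.differentiableAt (f' := ∮ w in C(c, R), (w - z)⁻¹ * ((w - z)⁻¹ * f w)) ?_
  rw [hasDerivAt_iff_tendsto_slope]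
  have key := tendsto_circleIntegral_of_continuousOn_prod
    (F := fun y w => (w - y)⁻¹ * ((w - z)⁻¹ * f w)) hR hU (by
      refine ContinuousOn.mul ?_ (ContinuousOn.mul ?_ ?_)
      · exact ContinuousOn.inv₀ (by fun_prop) fun p hp => hne _ hp.1 _ hp.2
      · exact ContinuousOn.inv₀ (by fun_prop) fun p hp => hne _ hz _ hp.2
      · exact hf.comp (by fun_prop) fun p hp => hp.2)
  refine (key.mono_left nhdsWithin_le_nhds).congr' ?_
  filter_upwards [nhdsWithin_le_nhds hU, self_mem_nhdsWithin] with y hy hyz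
  have hint : ∀ y ∉ sphere c R, CircleIntegrable (fun w => (w - y)⁻¹ * f w) c R := by
    intro y hy
    refine ContinuousOn.circleIntegrable hR (ContinuousOn.mul ?_ hf)
    exact ContinuousOn.inv₀ (by fun_prop) fun w hw => hne _ hy _ hw
  rw [slope_def_field, ← circleIntegral.integral_sub (hint y hy) (hint z hz), div_eq_inv_mul,
    ← circleIntegral.integral_const_mul]
  refine circleIntegral.integral_congr hR fun w hw => ?_
  have h1 := hne _ hy _ hw
  have h2 := hne _ hz _ hw
  have h3 : y - z ≠ 0 := sub_ne_zero.2 hyz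
  field_simp
  ring

/-- With `t = z⁻¹` the kernel `z / (w - z)` becomes `(t w - 1)⁻¹`, which is continuous at `t = 0`
with value `-1`. -/
theorem tendsto_mul_cauchyTransform {f : ℂ → ℂ} {c : ℂ} {R : ℝ} (hR : 0 ≤ R)
    (hf : ContinuousOn f (sphere c R)) :
    Tendsto (fun z => z * cauchyTransform f c R z) (cocompact ℂ)
      (𝓝 (-((2 * Real.pi * Complex.I)⁻¹ * ∮ w in C(c, R), f w))) := by
  obtain ⟨B, hB0, hB⟩ : ∃ B > 0, ∀ w ∈ sphere c R, ‖w‖ ≤ B := by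
    obtain ⟨B, hB⟩ := (isCompact_sphere c R).isBounded.exists_norm_le
    exact ⟨max B 1, by positivity, fun w hw => (hB w hw).trans (le_max_left _ _)⟩
  have hne : ∀ t ∈ ball (0 : ℂ) B⁻¹, ∀ w ∈ sphere c R, t * w - 1 ≠ 0 := by
    intro t ht w hw h
    have h1 : ‖t‖ * ‖w‖ = 1 := by rw [← norm_mul, sub_eq_zero.1 h, norm_one]
    have h2 : ‖t‖ < B⁻¹ := by simpa using ht
    have h3 : ‖t‖ * ‖w‖ ≤ ‖t‖ * B := mul_le_mul_of_nonneg_left (hB w hw) (norm_nonneg _)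
    have h4 : ‖t‖ * B < B⁻¹ * B := mul_lt_mul_of_pos_right h2 hB0
    rw [inv_mul_cancel₀ hB0.ne'] at h4
    linarith
  have key := tendsto_circleIntegral_of_continuousOn_prod (x := 0)
    (F := fun t w => (t * w - 1)⁻¹ * f w) hR (ball_mem_nhds (0 : ℂ) (inv_pos.2 hB0)) (by
      refine ContinuousOn.mul ?_ ?_
      · exact ContinuousOn.inv₀ (by fun_prop) fun p hp => hne _ hp.1 _ hp.2
      · exact hf.comp (by fun_prop) fun p hp => hp.2)
  have hinv : Tendsto (fun z : ℂ => z⁻¹) (cocompact ℂ) (𝓝 0) := by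
    simpa [Metric.cobounded_eq_cocompact] using Filter.tendsto_inv₀_cobounded (α := ℂ)
  have := (key.comp hinv).const_mul (2 * Real.pi * Complex.I)⁻¹
  have hlim : (2 * Real.pi * Complex.I)⁻¹ * ∮ w in C(c, R), ((0 : ℂ) * w - 1)⁻¹ * f w
      = -((2 * Real.pi * Complex.I)⁻¹ * ∮ w in C(c, R), f w) := by
    have h1 : ∀ w : ℂ, ((0 : ℂ) * w - 1)⁻¹ * f w = -1 * f w := fun w => by norm_num
    simp only [h1, circleIntegral.integral_const_mul]
    ring
  rw [hlim] at this
  refine this.congr' ?_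
  have hz0 : ∀ᶠ z : ℂ in cocompact ℂ, z ≠ 0 :=
    (isCompact_singleton (x := (0 : ℂ))).compl_mem_cocompact
  filter_upwards [hz0] with z hz
  rw [cauchyTransform, mul_left_comm z, ← circleIntegral.integral_const_mul]
  simp only [Function.comp]
  congr 1
  refine circleIntegral.integral_congr hR fun w _ => ?_
  have : z⁻¹ * w - 1 = z⁻¹ * (w - z) := by field_simp
  simp only [this, mul_inv, inv_inv, mul_assoc]

theorem tendsto_zero_of_tendsto_mul {f : ℂ → ℂ} {l : ℂ}
    (hf : Tendsto (fun z => z * f z) (cocompact ℂ) (𝓝 l)) : Tendsto f (cocompact ℂ) (𝓝 0) := by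
  have hinv : Tendsto (fun z : ℂ => z⁻¹) (cocompact ℂ) (𝓝 0) := by
    simpa [Metric.cobounded_eq_cocompact] using Filter.tendsto_inv₀_cobounded (α := ℂ)
  have := hinv.mul hf
  rw [zero_mul] at this
  refine this.congr' ?_
  filter_upwards [(isCompact_singleton (x := (0 : ℂ))).compl_mem_cocompact] with z hz
  have : z ≠ 0 := hz
  field_simp

/-- A function analytic on a circle is analytic on a closed annulus around it. -/
theorem exists_annulus_analytic {f : ℂ → ℂ} {c : ℂ} {r : ℝ} (hr : 0 < r)
    (hf : AnalyticOnNhd ℂ f (sphere c r)) :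
    ∃ ρ R, 0 < ρ ∧ ρ < r ∧ r < R ∧ AnalyticOnNhd ℂ f (closedBall c R \ ball c ρ) := by
  obtain ⟨δ, hδ, h⟩ := (isCompact_sphere c r).exists_thickening_subset_open
    (isOpen_analyticAt ℂ f) hf
  -- Half of `min r δ` keeps the inner radius positive and the closed annulus inside the open
  -- `δ`-thickening.
  refine ⟨r - min (r / 2) (δ / 2), r + min (r / 2) (δ / 2), ?_, ?_, ?_, ?_⟩
  · have := min_le_left (r / 2) (δ / 2); linarith
  · have : 0 < min (r / 2) (δ / 2) := by positivity
    linarith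
  · have : 0 < min (r / 2) (δ / 2) := by positivity
    linarith
  · rintro z ⟨hz1, hz2⟩
    apply h
    have h1 := min_le_left (r / 2) (δ / 2)
    have h2 := min_le_right (r / 2) (δ / 2)
    simp only [mem_closedBall, mem_ball, not_lt, dist_eq_norm] at hz1 hz2
    have hn : 0 < ‖z - c‖ := by linarith
    rw [mem_thickening_iff]
    refine ⟨c + (r / ‖z - c‖ : ℝ) • (z - c), ?_, ?_⟩
    · simp only [mem_sphere, dist_eq_norm, add_sub_cancel_left, norm_smul, norm_div,
        Real.norm_eq_abs, abs_of_pos hr, abs_of_pos hn]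
      field_simp
    · have : z - (c + (r / ‖z - c‖ : ℝ) • (z - c)) = ((‖z - c‖ - r) / ‖z - c‖ : ℝ) • (z - c) := by
        rw [sub_div, div_self hn.ne', sub_smul, one_smul]; ring
      rw [dist_eq_norm, this, norm_smul, norm_div, norm_norm, div_mul_cancel₀ _ hn.ne',
        Real.norm_eq_abs, abs_lt]
      constructor <;> linarith

/-- Laurent decomposition in an annulus. -/
theorem eq_cauchyTransform_sub {f : ℂ → ℂ} {c z : ℂ} {ρ R : ℝ} (hρ : 0 < ρ)
    (hf : AnalyticOnNhd ℂ f (closedBall c R \ ball c ρ)) (hz : z ∈ ball c R \ closedBall c ρ) :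
    f z = cauchyTransform f c R z - cauchyTransform f c ρ z := by
  have hρR : ρ < R := by
    have h1 := hz.1; have h2 := hz.2
    simp only [mem_ball, mem_closedBall, not_le] at h1 h2
    linarith
  have hπ : (2 * Real.pi * Complex.I : ℂ) ≠ 0 := Complex.two_pi_I_ne_zero
  have hopen : IsOpen (ball c R \ closedBall c ρ) := isOpen_ball.sdiff isClosed_closedBall
  have hsub : ball c R \ closedBall c ρ ⊆ closedBall c R \ ball c ρ :=
    sdiff_subset_sdiff ball_subset_closedBall ball_subset_closedBall
  have hdiff : ∀ w ∈ ball c R \ closedBall c ρ, DifferentiableAt ℂ (dslope f z) w := by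
    have : DifferentiableOn ℂ (dslope f z) (ball c R \ closedBall c ρ) :=
      (Complex.differentiableOn_dslope (hopen.mem_nhds hz)).2
        (hf.mono hsub).differentiableOn
    exact fun w hw => this.differentiableAt (hopen.mem_nhds hw)
  have hcont : ContinuousOn (dslope f z) (closedBall c R \ ball c ρ) := by
    refine (continuousOn_dslope (mem_of_superset (hopen.mem_nhds hz) hsub)).2
      ⟨hf.continuousOn, (hf z (hsub hz)).differentiableAt⟩
  -- `dslope f z` has no singularity at `z`, so its integrals over the two circles agree. Expanding
  -- it as `(f w - f z) / (w - z)` gives the formula: the integral of `(w - z)⁻¹` is `2πi` over the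
  -- outer circle and `0` over the inner one.
  have key := Complex.circleIntegral_eq_of_differentiable_on_annulus_off_countable hρ hρR.le
    countable_empty hcont fun w hw => hdiff w hw.1
  have hsphR : sphere c R ⊆ closedBall c R \ ball c ρ := by
    intro w hw
    simp only [mem_sphere, Set.mem_sdiff, mem_closedBall, mem_ball, not_lt] at hw ⊢
    constructor <;> linarith
  have hsphρ : sphere c ρ ⊆ closedBall c R \ ball c ρ := by
    intro w hw
    simp only [mem_sphere, Set.mem_sdiff, mem_closedBall, mem_ball, not_lt] at hw ⊢
    constructor <;> linarith
  have hzR : z ∉ sphere c R := fun h => (mem_sphere.1 h ▸ hz.1 : dist z c < R).ne (mem_sphere.1 h)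
  have hzρ : z ∉ sphere c ρ := fun h => hz.2 (sphere_subset_closedBall h)
  have expand : ∀ r : ℝ, 0 < r → sphere c r ⊆ closedBall c R \ ball c ρ → z ∉ sphere c r →
      (∮ w in C(c, r), dslope f z w) = (∮ w in C(c, r), (w - z)⁻¹ * f w)
        - f z * ∮ w in C(c, r), (w - z)⁻¹ := by
    intro r hr hs hzr
    have hne : ∀ w ∈ sphere c r, w - z ≠ 0 := fun w hw h => hzr (sub_eq_zero.1 h ▸ hw)
    have hi : ContinuousOn (fun w => (w - z)⁻¹) (sphere c r) :=
      ContinuousOn.inv₀ (by fun_prop) hne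
    rw [← circleIntegral.integral_const_mul, ← circleIntegral.integral_sub]
    · refine circleIntegral.integral_congr hr.le fun w hw => ?_
      have : w ≠ z := sub_ne_zero.1 (hne w hw)
      simp only [dslope_of_ne _ this, slope_def_field]
      field_simp
    · exact (hi.mul (hf.continuousOn.mono hs)).circleIntegrable hr.le
    · exact (continuousOn_const.mul hi).circleIntegrable hr.le
  have hzero : (∮ w in C(c, ρ), (w - z)⁻¹) = 0 := by
    refine DiffContOnCl.circleIntegral_eq_zero hρ.le ?_
    refine DifferentiableOn.diffContOnCl_ball (U := closedBall c ρ) ?_ subset_rfl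
    intro w hw
    have : w - z ≠ 0 := fun h => hz.2 (sub_eq_zero.1 h ▸ hw)
    exact ((differentiableAt_id.sub_const z).inv this).differentiableWithinAt
  rw [expand R (hρ.trans hρR) hsphR hzR, expand ρ hρ hsphρ hzρ, hzero,
    circleIntegral.integral_sub_inv_of_mem_ball hz.1] at key
  simp only [cauchyTransform]
  rw [← mul_sub]
  rw [eq_inv_mul_iff_mul_eq₀ hπ]
  linear_combination -key

end Whitham

/-! ### Geometry of the disks and the splitting `f = f_+ + f_-` -/

namespace Whitham

open Metric Set

variable {m : ℕ}

namespace DiskConfig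

section Geometry

variable (D : DiskConfig m)

theorem isCompact_interiorDomain : IsCompact D.interiorDomain :=
  isCompact_iUnion fun _ => isCompact_closedBall _ _

theorem isCompact_contour : IsCompact D.contour :=
  isCompact_iUnion fun _ => isCompact_sphere _ _

theorem closedBall_subset_interiorDomain (j : Fin m) :
    closedBall (D.center j) (D.radius j) ⊆ D.interiorDomain :=
  subset_iUnion (fun j => closedBall (D.center j) (D.radius j)) j

theorem sphere_subset_contour (j : Fin m) :
    sphere (D.center j) (D.radius j) ⊆ D.contour :=
  subset_iUnion (fun j => sphere (D.center j) (D.radius j)) j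

theorem contour_subset_interiorDomain : D.contour ⊆ D.interiorDomain :=
  iUnion_mono fun _ => sphere_subset_closedBall

theorem eq_of_mem_closedBall {z : ℂ} {i j : Fin m}
    (hi : z ∈ closedBall (D.center i) (D.radius i))
    (hj : z ∈ closedBall (D.center j) (D.radius j)) : i = j := by
  by_contra h
  exact Set.disjoint_left.1 (D.disjoint i j h) hi hj

theorem contour_subset_exteriorDomain : D.contour ⊆ D.exteriorDomain := by
  rintro z hz h
  obtain ⟨i, hi⟩ := mem_iUnion.1 hz
  obtain ⟨j, hj⟩ := mem_iUnion.1 h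
  obtain rfl := D.eq_of_mem_closedBall (sphere_subset_closedBall hi) (ball_subset_closedBall hj)
  rw [mem_ball, mem_sphere.1 hi] at hj
  exact lt_irrefl _ hj

theorem mem_exteriorDomain_of_notMem {z : ℂ} (hz : z ∉ D.interiorDomain) :
    z ∈ D.exteriorDomain := by
  intro h
  obtain ⟨j, hj⟩ := mem_iUnion.1 h
  exact hz (D.closedBall_subset_interiorDomain j (ball_subset_closedBall hj))

theorem interiorDomain_mem_nhds_or_mem_contour {z : ℂ} (hz : z ∈ D.interiorDomain) :
    D.interiorDomain ∈ 𝓝 z ∨ z ∈ D.contour := by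
  obtain ⟨j, hj⟩ := mem_iUnion.1 hz
  rcases (mem_closedBall.1 hj).lt_or_eq with h | h
  · left
    exact mem_of_superset (isOpen_ball.mem_nhds (mem_ball.2 h))
      (ball_subset_closedBall.trans (D.closedBall_subset_interiorDomain j))
  · exact Or.inr (D.sphere_subset_contour j h)

theorem mem_contour_of_mem_of_mem {z : ℂ} (hz : z ∈ D.interiorDomain)
    (hz' : z ∈ D.exteriorDomain) : z ∈ D.contour := by
  obtain ⟨j, hj⟩ := mem_iUnion.1 hz
  rcases (mem_closedBall.1 hj).lt_or_eq with h | h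
  · exact absurd (mem_iUnion.2 ⟨j, mem_ball.2 h⟩) hz'
  · exact D.sphere_subset_contour j h

theorem compl_interiorDomain_mem_cocompact : D.interiorDomainᶜ ∈ cocompact ℂ :=
  D.isCompact_interiorDomain.compl_mem_cocompact

theorem isOpen_cell (k : Fin m) : IsOpen (D.cell k) := by
  have : D.cell k = ⋂ j, {z | j ≠ k →
      dist z (D.center k) - D.radius k < dist z (D.center j) - D.radius j} := by
    ext z; simp [cell]
  rw [this]
  refine isOpen_iInter_of_finite fun j => ?_
  by_cases h : j = k
  · simp [h]
  · simp only [ne_eq, h, not_false_eq_true, forall_const]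
    exact isOpen_lt (by fun_prop) (by fun_prop)

theorem closedBall_subset_cell (k : Fin m) :
    closedBall (D.center k) (D.radius k) ⊆ D.cell k := by
  intro z hz j hj
  have h1 : z ∉ closedBall (D.center j) (D.radius j) :=
    fun h => hj (D.eq_of_mem_closedBall h hz)
  rw [mem_closedBall] at hz h1
  linarith

theorem charFun_eventuallyEq {z : ℂ} {j : Fin m}
    (hz : z ∈ closedBall (D.center j) (D.radius j)) (k : Fin m) :
    D.charFun k =ᶠ[𝓝 z] fun _ => if j = k then 1 else 0 := by
  filter_upwards [(D.isOpen_cell j).mem_nhds (D.closedBall_subset_cell j hz)] with w hw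
  rw [charFun]
  split_ifs with h
  · subst h; simp [hw]
  · refine indicator_of_notMem (fun hk => ?_) _
    have h1 := hw k (Ne.symm h)
    have h2 := hk j h
    linarith

theorem analyticOnNhd_charFun (k : Fin m) : AnalyticOnNhd ℂ (D.charFun k) D.interiorDomain := by
  intro z hz
  obtain ⟨j, hj⟩ := mem_iUnion.1 hz
  exact analyticAt_const.congr (D.charFun_eventuallyEq hj k).symm

theorem sum_charFun_eventuallyEq {z : ℂ} (hz : z ∈ D.interiorDomain) :
    (fun w => ∑ k, D.charFun k w) =ᶠ[𝓝 z] fun _ => 1 := by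
  obtain ⟨j, hj⟩ := mem_iUnion.1 hz
  have := eventually_all.2 fun k => D.charFun_eventuallyEq hj k
  filter_upwards [this] with w hw
  simp [hw]

end Geometry

variable {D : DiskConfig m}

section Splitting

/-- The differences `p - p'` on `D^int` and `q' - q` on `D^ext` agree near `γ`, hence glue to an
entire function that tends to `0` at infinity; Liouville makes it zero. The conclusions hold on
neighbourhoods of the closed domains, so derivatives are determined as well. -/
theorem IsSplitting.unique {f g p q p' q' : ℂ → ℂ} (h : D.IsSplitting f p q)
    (h' : D.IsSplitting g p' q') (hfg : f =ᶠ[𝓝ˢ D.contour] g) :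
    p =ᶠ[𝓝ˢ D.interiorDomain] p' ∧ q =ᶠ[𝓝ˢ D.exteriorDomain] q' := by
  classical
  obtain ⟨hp, hq, hq0, hf⟩ := h
  obtain ⟨hp', hq', hq0', hf'⟩ := h'
  have hC : ∀ᶠ z in 𝓝ˢ D.contour, p z - p' z = q' z - q z := by
    filter_upwards [hf, hf', hfg] with z h1 h2 h3
    linear_combination h2 - h1 + h3
  rw [eventually_nhdsSet_iff_forall] at hC
  set G : ℂ → ℂ := fun z => if z ∈ D.interiorDomain then p z - p' z else q' z - q z with hG
  have hGC : ∀ z ∈ D.contour, ∀ᶠ w in 𝓝 z, G w = p w - p' w ∧ G w = q' w - q w := by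
    intro z hz
    filter_upwards [hC z hz] with w hw
    simp only [hG]
    split_ifs <;> simp [hw]
  have hGI : ∀ z ∈ D.interiorDomain, G =ᶠ[𝓝 z] fun w => p w - p' w := by
    intro z hz
    rcases D.interiorDomain_mem_nhds_or_mem_contour hz with h | h
    · filter_upwards [h] with w hw
      simp [hG, hw]
    · exact (hGC z h).mono fun w hw => hw.1
  have hGE : ∀ z ∈ D.exteriorDomain, G =ᶠ[𝓝 z] fun w => q' w - q w := by
    intro z hz
    by_cases hzI : z ∈ D.interiorDomain
    · exact (hGC z (D.mem_contour_of_mem_of_mem hzI hz)).mono fun w hw => hw.2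
    · filter_upwards [D.isCompact_interiorDomain.isClosed.isOpen_compl.mem_nhds hzI] with w hw
      have hw : w ∉ D.interiorDomain := hw
      simp [hG, hw]
  have hdiff : Differentiable ℂ G := by
    intro z
    by_cases hz : z ∈ D.interiorDomain
    · exact ((hp z hz).sub (hp' z hz)).differentiableAt.congr_of_eventuallyEq (hGI z hz)
    · have hz := D.mem_exteriorDomain_of_notMem hz
      exact ((hq' z hz).sub (hq z hz)).differentiableAt.congr_of_eventuallyEq (hGE z hz)
  have hlim : Tendsto G (cocompact ℂ) (𝓝 0) := by
    have := hq0'.sub hq0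
    rw [sub_zero] at this
    refine this.congr' ?_
    filter_upwards [D.compl_interiorDomain_mem_cocompact] with w hw
    have hw : w ∉ D.interiorDomain := hw
    simp [hG, hw]
  have hzero : ∀ z, G z = 0 := fun z => hdiff.apply_eq_of_tendsto_cocompact z hlim
  constructor
  · refine eventually_nhdsSet_iff_forall.2 fun z hz => ?_
    filter_upwards [hGI z hz] with w hw
    exact sub_eq_zero.1 (hw ▸ hzero w)
  · refine eventually_nhdsSet_iff_forall.2 fun z hz => ?_
    filter_upwards [hGE z hz] with w hw
    exact (sub_eq_zero.1 (hw ▸ hzero w)).symm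

theorem analyticAt_cauchyTransform {f : ℂ → ℂ} {c z : ℂ} {R : ℝ} (hR : 0 ≤ R)
    (hf : ContinuousOn f (sphere c R)) (hz : z ∉ sphere c R) :
    AnalyticAt ℂ (cauchyTransform f c R) z := by
  rw [Complex.analyticAt_iff_eventually_differentiableAt]
  filter_upwards [isClosed_sphere.isOpen_compl.mem_nhds hz] with w hw
  exact differentiableAt_cauchyTransform hR hf hw

/-- Near `γ_j`, `f = P_j - N_j` with Cauchy integrals over a slightly larger and a slightly smaller
circle. The minus part is `-∑ N_i`; on `D_j` the plus part is `P_j` plus the `N_i` with `i ≠ j`,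
which are analytic there. The leading coefficient of this minus part at infinity is the contour
integral of `f`; it later identifies integrals over `γ` with behaviour at infinity. -/
theorem exists_isSplitting {f : ℂ → ℂ} (hf : AnalyticOnNhd ℂ f D.contour) :
    ∃ p q, D.IsSplitting f p q ∧
      Tendsto (fun z => z * q z) (cocompact ℂ) (𝓝 (D.totalInt f)) := by
  classical
  choose ρ R hρ hρr hrR han using fun j => exists_annulus_analytic (D.radius_pos j)
    (hf.mono (D.sphere_subset_contour j))
  have hcρ : ∀ j, ContinuousOn f (sphere (D.center j) (ρ j)) := fun j =>
    (han j).continuousOn.mono fun w hw => by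
      have := mem_sphere.1 hw
      refine ⟨?_, ?_⟩
      · rw [mem_closedBall]; linarith [hρr j, hrR j]
      · rw [mem_ball]; linarith [hρr j, hrR j]
  have hcR : ∀ j, ContinuousOn f (sphere (D.center j) (R j)) := fun j =>
    (han j).continuousOn.mono fun w hw => by
      have := mem_sphere.1 hw
      refine ⟨?_, ?_⟩
      · rw [mem_closedBall]; linarith [hρr j, hrR j]
      · rw [mem_ball]; linarith [hρr j, hrR j]
  set P : Fin m → ℂ → ℂ := fun j => cauchyTransform f (D.center j) (R j) with hP
  set N : Fin m → ℂ → ℂ := fun j => cauchyTransform f (D.center j) (ρ j) with hN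
  have hNan : ∀ j z, z ∉ ball (D.center j) (D.radius j) → AnalyticAt ℂ (N j) z := by
    intro j z hz
    refine analyticAt_cauchyTransform (hρ j).le (hcρ j) fun h => hz ?_
    rw [mem_ball, mem_sphere.1 h]; exact hρr j
  have hPan : ∀ j, ∀ z ∈ closedBall (D.center j) (D.radius j), AnalyticAt ℂ (P j) z := by
    intro j z hz
    have h0 := D.radius_pos j
    refine analyticAt_cauchyTransform (by linarith [hrR j]) (hcR j) fun h => ?_
    rw [mem_closedBall, mem_sphere.1 h] at hz
    linarith [hrR j]
  set p : ℂ → ℂ := fun z => ∑ j, D.charFun j z * (P j z + ∑ i ∈ Finset.univ.erase j, N i z)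
  set q : ℂ → ℂ := fun z => -∑ j, N j z
  have hpeq : ∀ j, ∀ z ∈ closedBall (D.center j) (D.radius j),
      p =ᶠ[𝓝 z] fun w => P j w + ∑ i ∈ Finset.univ.erase j, N i w := by
    intro j z hz
    filter_upwards [eventually_all.2 fun k => D.charFun_eventuallyEq hz k] with w hw
    simp [p, hw]
  have htend : Tendsto (fun z => z * q z) (cocompact ℂ) (𝓝 (D.totalInt f)) := by
    have h1 : ∀ j, Tendsto (fun z => z * N j z) (cocompact ℂ) (𝓝 (-D.contourInt j f)) := by
      intro j
      have := tendsto_mul_cauchyTransform (hρ j).le (hcρ j)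
      rw [contourInt, Complex.circleIntegral_eq_of_differentiable_on_annulus_off_countable (hρ j)
        (hρr j).le countable_empty]
      · exact this
      · exact (han j).continuousOn.mono
          (sdiff_subset_sdiff_left (closedBall_subset_closedBall (hrR j).le))
      · rintro z ⟨⟨h1, h2⟩, -⟩
        exact (han j z ⟨ball_subset_closedBall (ball_subset_ball (hrR j).le h1),
          fun h => h2 (ball_subset_closedBall h)⟩).differentiableAt
    have h2 := (tendsto_finsetSum Finset.univ fun j _ => h1 j).neg
    simp only [Finset.sum_neg_distrib, neg_neg] at h2
    refine h2.congr fun z => ?_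
    simp [q, Finset.mul_sum]
  refine ⟨p, q, ⟨?_, ?_, tendsto_zero_of_tendsto_mul htend, ?_⟩, htend⟩
  · intro z hz
    obtain ⟨j, hj⟩ := mem_iUnion.1 hz
    refine AnalyticAt.congr ?_ (hpeq j z hj).symm
    refine (hPan j z hj).add (Finset.analyticAt_fun_sum _ fun i hi => hNan i z fun h => ?_)
    exact Finset.ne_of_mem_erase hi (D.eq_of_mem_closedBall (ball_subset_closedBall h) hj)
  · intro z hz
    refine (Finset.analyticAt_fun_sum _ fun i _ => hNan i z fun h => ?_).neg
    exact hz (mem_iUnion.2 ⟨i, h⟩)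
  · refine eventually_nhdsSet_iff_forall.2 fun z hz => ?_
    obtain ⟨j, hj⟩ := mem_iUnion.1 hz
    have hopen : IsOpen (ball (D.center j) (R j) \ closedBall (D.center j) (ρ j)) :=
      isOpen_ball.sdiff isClosed_closedBall
    filter_upwards [hpeq j z (sphere_subset_closedBall hj), hopen.mem_nhds (x := z) (by
      have := mem_sphere.1 hj
      refine ⟨?_, ?_⟩
      · rw [mem_ball]; linarith [hρr j, hrR j]
      · rw [mem_closedBall]; linarith [hρr j, hrR j])] with w hw hwm
    rw [hw, eq_cauchyTransform_sub (hρ j) (han j) hwm]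
    have hsum := Finset.add_sum_erase Finset.univ (fun i => N i w) (Finset.mem_univ j)
    simp only [q, hP, hN] at hsum ⊢
    linear_combination -hsum

theorem isSplitting_splitting {f : ℂ → ℂ} (hf : AnalyticOnNhd ℂ f D.contour) :
    D.IsSplitting f (D.splitting f).1 (D.splitting f).2 := by
  obtain ⟨p, q, h, -⟩ := D.exists_isSplitting hf
  have hex : ∃ g : (ℂ → ℂ) × (ℂ → ℂ), D.IsSplitting f g.1 g.2 := ⟨(p, q), h⟩
  rw [splitting, dif_pos hex]
  exact hex.choose_spec

theorem plusPart_add_minusPart (f : ℂ → ℂ) (z : ℂ) : D.plusPart f z + D.minusPart f z = f z := by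
  rw [plusPart, minusPart]; split_ifs <;> ring

theorem plusPart_eventuallyEq {f : ℂ → ℂ} (hf : AnalyticOnNhd ℂ f D.contour) :
    D.plusPart f =ᶠ[𝓝ˢ D.interiorDomain] (D.splitting f).1 := by
  refine eventually_nhdsSet_iff_forall.2 fun z hz => ?_
  rcases D.interiorDomain_mem_nhds_or_mem_contour hz with h | h
  · filter_upwards [h] with w hw
    simp [plusPart, hw]
  · have := eventually_nhdsSet_iff_forall.1 (isSplitting_splitting hf).2.2.2 z h
    filter_upwards [this] with w hw
    rw [plusPart]
    split_ifs
    · rfl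
    · linear_combination hw

theorem minusPart_eventuallyEq {f : ℂ → ℂ} (hf : AnalyticOnNhd ℂ f D.contour) :
    D.minusPart f =ᶠ[𝓝ˢ D.exteriorDomain] (D.splitting f).2 := by
  refine eventually_nhdsSet_iff_forall.2 fun z hz => ?_
  by_cases hzI : z ∈ D.interiorDomain
  · have := eventually_nhdsSet_iff_forall.1 (isSplitting_splitting hf).2.2.2 z
      (D.mem_contour_of_mem_of_mem hzI hz)
    filter_upwards [this] with w hw
    rw [minusPart]
    split_ifs
    · linear_combination hw
    · rfl
  · filter_upwards [D.isCompact_interiorDomain.isClosed.isOpen_compl.mem_nhds hzI] with w hw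
    have hw : w ∉ D.interiorDomain := hw
    simp [minusPart, hw]

theorem IsSplitting.congr {f p q p' q' : ℂ → ℂ} (h : D.IsSplitting f p q)
    (hp : p' =ᶠ[𝓝ˢ D.interiorDomain] p) (hq : q' =ᶠ[𝓝ˢ D.exteriorDomain] q) :
    D.IsSplitting f p' q' := by
  obtain ⟨h1, h2, h3, h4⟩ := h
  refine ⟨fun z hz => (h1 z hz).congr (hp.filter_mono (nhds_le_nhdsSet hz)).symm,
    fun z hz => (h2 z hz).congr (hq.filter_mono (nhds_le_nhdsSet hz)).symm,
    h3.congr' ?_, ?_⟩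
  · filter_upwards [D.compl_interiorDomain_mem_cocompact] with z hz
    exact (hq.self_of_nhdsSet (D.mem_exteriorDomain_of_notMem hz)).symm
  · filter_upwards [h4, nhdsSet_mono D.contour_subset_interiorDomain hp,
      nhdsSet_mono D.contour_subset_exteriorDomain hq] with z h1 h2 h3
    rw [h1, h2, h3]

theorem isSplitting_plusPart_minusPart {f : ℂ → ℂ} (hf : AnalyticOnNhd ℂ f D.contour) :
    D.IsSplitting f (D.plusPart f) (D.minusPart f) :=
  (isSplitting_splitting hf).congr (plusPart_eventuallyEq hf) (minusPart_eventuallyEq hf)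

theorem IsSplitting.analyticOnNhd {f p q : ℂ → ℂ} (h : D.IsSplitting f p q) :
    AnalyticOnNhd ℂ f D.contour := by
  intro z hz
  exact ((h.1 z (D.contour_subset_interiorDomain hz)).add
    (h.2.1 z (D.contour_subset_exteriorDomain hz))).congr
    (EventuallyEq.symm (h.2.2.2.filter_mono (nhds_le_nhdsSet hz)))

theorem IsSplitting.plusPart_eq {f p q : ℂ → ℂ} (h : D.IsSplitting f p q) :
    D.plusPart f =ᶠ[𝓝ˢ D.interiorDomain] p :=
  ((isSplitting_plusPart_minusPart h.analyticOnNhd).unique h (EventuallyEq.refl _ _)).1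

theorem IsSplitting.minusPart_eq {f p q : ℂ → ℂ} (h : D.IsSplitting f p q) :
    D.minusPart f =ᶠ[𝓝ˢ D.exteriorDomain] q :=
  ((isSplitting_plusPart_minusPart h.analyticOnNhd).unique h (EventuallyEq.refl _ _)).2

theorem analyticOnNhd_plusPart {f : ℂ → ℂ} (hf : AnalyticOnNhd ℂ f D.contour) :
    AnalyticOnNhd ℂ (D.plusPart f) D.interiorDomain := (isSplitting_plusPart_minusPart hf).1

theorem analyticOnNhd_minusPart {f : ℂ → ℂ} (hf : AnalyticOnNhd ℂ f D.contour) :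
    AnalyticOnNhd ℂ (D.minusPart f) D.exteriorDomain := (isSplitting_plusPart_minusPart hf).2.1

theorem tendsto_minusPart {f : ℂ → ℂ} (hf : AnalyticOnNhd ℂ f D.contour) :
    Tendsto (D.minusPart f) (cocompact ℂ) (𝓝 0) := (isSplitting_plusPart_minusPart hf).2.2.1

/-- A function analytic on the exterior domain that vanishes at infinity behaves there like its
contour integral times `z⁻¹`. -/
theorem tendsto_mul_of_analyticOnNhd_exteriorDomain {h : ℂ → ℂ}
    (hh : AnalyticOnNhd ℂ h D.exteriorDomain) (h0 : Tendsto h (cocompact ℂ) (𝓝 0)) :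
    Tendsto (fun z => z * h z) (cocompact ℂ) (𝓝 (D.totalInt h)) := by
  obtain ⟨p, q, hs, ht⟩ :=
    D.exists_isSplitting (hh.mono D.contour_subset_exteriorDomain)
  have hs' : D.IsSplitting h (fun _ => 0) h :=
    ⟨fun _ _ => analyticAt_const, hh, h0, Eventually.of_forall fun z => (zero_add _).symm⟩
  have heq := (hs.unique hs' (EventuallyEq.refl _ _)).2
  refine ht.congr' ?_
  filter_upwards [D.compl_interiorDomain_mem_cocompact] with z hz
  rw [heq.self_of_nhdsSet (D.mem_exteriorDomain_of_notMem hz)]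

/-- Cauchy's estimate on the unit circle around a point `z` far away. -/
theorem tendsto_deriv_of_analyticOnNhd_exteriorDomain {h : ℂ → ℂ}
    (hh : AnalyticOnNhd ℂ h D.exteriorDomain) (h0 : Tendsto h (cocompact ℂ) (𝓝 0)) :
    Tendsto (deriv h) (cocompact ℂ) (𝓝 0) := by
  rw [Metric.tendsto_nhds] at h0 ⊢
  intro ε hε
  have h1 := (h0 (ε / 2) (by positivity)).and D.compl_interiorDomain_mem_cocompact
  rw [← Metric.cobounded_eq_cocompact, Filter.hasBasis_cobounded_norm.eventually_iff] at h1 ⊢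
  obtain ⟨r, -, hr⟩ := h1
  refine ⟨r + 1, trivial, fun z hz => ?_⟩
  have hball : ∀ w ∈ closedBall z 1, r ≤ ‖w‖ := by
    intro w hw
    have h1 : ‖z‖ ≤ ‖w‖ + ‖z - w‖ := by
      simpa using norm_add_le w (z - w)
    have h2 : ‖z - w‖ ≤ 1 := by rw [← dist_eq_norm, dist_comm]; exact hw
    have h3 : r + 1 ≤ ‖z‖ := hz
    linarith
  have := Complex.norm_deriv_le_of_forall_mem_sphere_norm_le (f := h) (c := z) (C := ε / 2)
    one_pos (DifferentiableOn.diffContOnCl_ball (U := closedBall z 1) (fun w hw =>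
      (hh w (D.mem_exteriorDomain_of_notMem (hr (hball w hw)).2)).differentiableAt.differentiableWithinAt)
      subset_rfl) fun w hw => by
        have := (hr (hball w (sphere_subset_closedBall hw))).1
        rw [dist_zero_right] at this
        exact this.le
  rw [dist_zero_right]
  linarith

theorem IsSplitting.deriv {f p q : ℂ → ℂ} (h : D.IsSplitting f p q) :
    D.IsSplitting (deriv f) (deriv p) (deriv q) := by
  refine ⟨h.1.deriv, h.2.1.deriv, tendsto_deriv_of_analyticOnNhd_exteriorDomain h.2.1 h.2.2.1, ?_⟩
  refine eventually_nhdsSet_iff_forall.2 fun z hz => ?_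
  filter_upwards [(eventually_nhdsSet_iff_forall.1 h.2.2.2 z hz).eventually_nhds,
    (h.1 z (D.contour_subset_interiorDomain hz)).eventually_analyticAt,
    (h.2.1 z (D.contour_subset_exteriorDomain hz)).eventually_analyticAt] with w h1 h2 h3
  rw [EventuallyEq.deriv_eq h1, deriv_fun_add h2.differentiableAt h3.differentiableAt]

end Splitting

end DiskConfig

end Whitham

/-! ### Vanishing contour integrals, and residues -/

namespace Whitham

open Metric Set

variable {m : ℕ}

namespace DiskConfig

section TotalInt

variable {D : DiskConfig m} {f g h : ℂ → ℂ}

theorem circleIntegrable_of_continuousOn_contour (hf : ContinuousOn f D.contour) (j : Fin m) :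
    CircleIntegrable f (D.center j) (D.radius j) :=
  (hf.mono (D.sphere_subset_contour j)).circleIntegrable (D.radius_pos j).le

theorem totalInt_congr (h : EqOn f g D.contour) : D.totalInt f = D.totalInt g := by
  refine Finset.sum_congr rfl fun j _ => ?_
  rw [contourInt, contourInt, circleIntegral.integral_congr (D.radius_pos j).le
    (h.mono (D.sphere_subset_contour j))]

theorem totalInt_add (hf : ContinuousOn f D.contour) (hg : ContinuousOn g D.contour) :
    D.totalInt (fun z => f z + g z) = D.totalInt f + D.totalInt g := by
  rw [totalInt, totalInt, totalInt, ← Finset.sum_add_distrib]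
  refine Finset.sum_congr rfl fun j _ => ?_
  rw [contourInt, contourInt, contourInt, circleIntegral.integral_add
    (circleIntegrable_of_continuousOn_contour hf j)
    (circleIntegrable_of_continuousOn_contour hg j), mul_add]

theorem totalInt_const_mul (c : ℂ) (f : ℂ → ℂ) :
    D.totalInt (fun z => c * f z) = c * D.totalInt f := by
  simp only [totalInt, contourInt, circleIntegral.integral_const_mul, Finset.mul_sum]
  exact Finset.sum_congr rfl fun j _ => by ring

theorem totalInt_neg (f : ℂ → ℂ) : D.totalInt (fun z => -f z) = -D.totalInt f := by
  simpa using D.totalInt_const_mul (-1) f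

/-- The integral of a function times `1_{γ_k}` is the integral over `γ_k`. -/
theorem totalInt_mul_charFun (k : Fin m) (f : ℂ → ℂ) :
    D.totalInt (fun z => f z * D.charFun k z) = D.contourInt k f := by
  rw [totalInt, Finset.sum_eq_single k]
  · rw [contourInt, contourInt, circleIntegral.integral_congr (D.radius_pos k).le]
    intro z hz
    simp [(D.charFun_eventuallyEq (sphere_subset_closedBall hz) k).self_of_nhds]
  · intro j _ hj
    rw [contourInt, circleIntegral.integral_congr (g := fun _ => 0) (D.radius_pos j).le]
    · simp [circleIntegral]
    · intro z hz
      simp [(D.charFun_eventuallyEq (sphere_subset_closedBall hz) k).self_of_nhds, hj]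
  · simp

variable (D) in
/-- Continuous functions on the contour whose integral vanishes. -/
structure IsNull (f : ℂ → ℂ) : Prop where
  continuousOn : ContinuousOn f D.contour
  totalInt_eq_zero : D.totalInt f = 0

theorem IsNull.add (hf : D.IsNull f) (hg : D.IsNull g) : D.IsNull fun z => f z + g z :=
  ⟨hf.1.add hg.1, by rw [totalInt_add hf.1 hg.1, hf.2, hg.2, add_zero]⟩

theorem IsNull.neg (hf : D.IsNull f) : D.IsNull fun z => -f z :=
  ⟨hf.1.neg, by rw [totalInt_neg, hf.2, neg_zero]⟩

theorem IsNull.sub (hf : D.IsNull f) (hg : D.IsNull g) : D.IsNull fun z => f z - g z := by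
  simpa only [sub_eq_add_neg] using hf.add hg.neg

theorem IsNull.congr (hf : D.IsNull f) (h : EqOn g f D.contour) : D.IsNull g :=
  ⟨hf.1.congr h, by rw [totalInt_congr h, hf.2]⟩

/-- The form in which contour integrals are compared below: `f - g` is written pointwise on `γ` as a
combination of null functions, so each identity of integrals becomes a polynomial identity. -/
theorem IsNull.totalInt_eq (hn : D.IsNull h) (hg : ContinuousOn g D.contour)
    (hfg : ∀ z ∈ D.contour, f z = g z + h z) : D.totalInt f = D.totalInt g := by
  rw [totalInt_congr hfg, totalInt_add hg hn.1, hn.2, add_zero]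

theorem isNull_of_interiorDomain (hf : AnalyticOnNhd ℂ f D.interiorDomain) : D.IsNull f := by
  refine ⟨hf.continuousOn.mono D.contour_subset_interiorDomain, ?_⟩
  refine Finset.sum_eq_zero fun j _ => ?_
  have : DiffContOnCl ℂ f (ball (D.center j) (D.radius j)) :=
    DifferentiableOn.diffContOnCl_ball
      (hf.mono (D.closedBall_subset_interiorDomain j)).differentiableOn subset_rfl
  rw [contourInt, this.circleIntegral_eq_zero (D.radius_pos j).le, mul_zero]

theorem isNull_deriv (hf : AnalyticOnNhd ℂ f D.contour) : D.IsNull (deriv f) := by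
  refine ⟨hf.deriv.continuousOn, Finset.sum_eq_zero fun j _ => ?_⟩
  rw [contourInt, circleIntegral.integral_eq_zero_of_hasDerivWithinAt (f := f)
    (D.radius_pos j).le, mul_zero]
  exact fun z hz =>
    (hf z (D.sphere_subset_contour j hz)).differentiableAt.hasDerivAt.hasDerivWithinAt

/-- The limit of `z f(z)` at infinity is the contour integral of `f`. -/
theorem isNull_of_exteriorDomain (hf : AnalyticOnNhd ℂ f D.exteriorDomain)
    (h0 : Tendsto (fun z => z * f z) (cocompact ℂ) (𝓝 0)) : D.IsNull f :=
  ⟨hf.continuousOn.mono D.contour_subset_exteriorDomain,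
    tendsto_nhds_unique (tendsto_mul_of_analyticOnNhd_exteriorDomain hf
      (tendsto_zero_of_tendsto_mul h0)) h0⟩

theorem isNull_mul_of_exteriorDomain (hf : AnalyticOnNhd ℂ f D.exteriorDomain)
    (hg : AnalyticOnNhd ℂ g D.exteriorDomain) (hf0 : Tendsto f (cocompact ℂ) (𝓝 0))
    (hg0 : Tendsto g (cocompact ℂ) (𝓝 0)) : D.IsNull fun z => f z * g z := by
  refine isNull_of_exteriorDomain (hf.mul hg) ?_
  have := (tendsto_mul_of_analyticOnNhd_exteriorDomain hf hf0).mul hg0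
  rw [mul_zero] at this
  simpa only [mul_assoc] using this

theorem isNull_mul_mul_of_exteriorDomain {l : ℂ} (hf : AnalyticOnNhd ℂ f D.exteriorDomain)
    (hg : AnalyticOnNhd ℂ g D.exteriorDomain) (hh : AnalyticOnNhd ℂ h D.exteriorDomain)
    (hf0 : Tendsto f (cocompact ℂ) (𝓝 0)) (hg0 : Tendsto g (cocompact ℂ) (𝓝 0))
    (hh0 : Tendsto h (cocompact ℂ) (𝓝 l)) : D.IsNull fun z => f z * g z * h z := by
  have := hg0.mul hh0
  rw [zero_mul] at this
  simpa only [mul_assoc] using isNull_mul_of_exteriorDomain hf (hg.mul hh) hf0 this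

/-- Integration by parts on the contour. -/
theorem isNull_deriv_mul_add (hf : AnalyticOnNhd ℂ f D.contour)
    (hg : AnalyticOnNhd ℂ g D.contour) :
    D.IsNull fun z => deriv f z * g z + f z * deriv g z :=
  (isNull_deriv (hf.mul hg)).congr fun z hz =>
    (deriv_mul (hf z hz).differentiableAt (hg z hz).differentiableAt).symm

end TotalInt

end DiskConfig

section Residue

variable {f g : ℂ → ℂ} {w r s : ℂ}

theorem eventually_forall_sphere {p : ℂ → Prop} (hp : ∀ᶠ z in 𝓝[≠] w, p z) :
    ∀ᶠ ρ : ℝ in 𝓝[>] 0, ∀ z ∈ sphere w ρ, p z := by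
  rw [eventually_nhdsWithin_iff, Metric.eventually_nhds_iff] at hp
  obtain ⟨ε, hε, h⟩ := hp
  filter_upwards [Ioo_mem_nhdsGT hε] with ρ hρ z hz
  refine h ?_ ?_
  · rw [mem_sphere.1 hz]; exact hρ.2
  · rintro rfl
    rw [mem_sphere, dist_self] at hz
    exact hρ.1.ne hz

/-- The circle integrals of `f` around `w` converge to `2πi r`. -/
def HasResidue (f : ℂ → ℂ) (w r : ℂ) : Prop :=
  Tendsto (fun ρ : ℝ => (2 * Real.pi * Complex.I)⁻¹ * ∮ z in C(w, ρ), f z) (𝓝[>] 0) (𝓝 r)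

theorem HasResidue.residue_eq (h : HasResidue f w r) : residue f w = r := h.limUnder_eq

theorem HasResidue.congr (h : HasResidue f w r) (hfg : f =ᶠ[𝓝[≠] w] g) : HasResidue g w r := by
  refine Tendsto.congr' ?_ h
  filter_upwards [eventually_forall_sphere hfg, self_mem_nhdsWithin] with ρ hρ hρ0
  rw [circleIntegral.integral_congr (le_of_lt hρ0) hρ]

theorem eventually_circleIntegrable (hf : MeromorphicAt f w) :
    ∀ᶠ ρ : ℝ in 𝓝[>] 0, CircleIntegrable f w ρ := by
  filter_upwards [eventually_forall_sphere hf.eventually_analyticAt, self_mem_nhdsWithin]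
    with ρ hρ hρ0
  exact ContinuousOn.circleIntegrable (le_of_lt hρ0)
    fun z hz => (hρ z hz).continuousAt.continuousWithinAt

theorem HasResidue.add (hf : HasResidue f w r) (hg : HasResidue g w s) (hfm : MeromorphicAt f w)
    (hgm : MeromorphicAt g w) : HasResidue (fun z => f z + g z) w (r + s) := by
  refine Tendsto.congr' ?_ (Tendsto.add hf hg)
  filter_upwards [eventually_circleIntegrable hfm, eventually_circleIntegrable hgm] with ρ h1 h2
  rw [circleIntegral.integral_add h1 h2, mul_add]

/-- The integral of a function with one pole in a disk over the boundary circle is the integral over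
small circles around the pole. -/
theorem hasResidue_of_analyticOnNhd {c : ℂ} {R : ℝ} (hw : w ∈ ball c R)
    (hf : AnalyticOnNhd ℂ f (closedBall c R \ {w})) (hfm : MeromorphicAt f w) :
    HasResidue f w ((2 * Real.pi * Complex.I)⁻¹ * ∮ z in C(c, R), f z) := by
  have hR : 0 < R := pos_of_mem_ball hw
  obtain ⟨n, hn⟩ := hfm
  set G : ℂ → ℂ := fun z => (z - w) ^ n • f z with hGdef
  have hG : AnalyticOnNhd ℂ G (closedBall c R) := by
    intro z hz
    by_cases h : z = w
    · exact h ▸ hn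
    · exact ((analyticAt_id.sub analyticAt_const).pow n).smul (hf z ⟨hz, h⟩)
  -- Induction on the pole order, splitting off `G = G(w) + (z - w) · dslope G w`. The integral of
  -- `(z - w)^(-n-1)` is the same over every circle around `w`: `2πi` for `n = 0` and `0` otherwise.
  have key : ∀ (n : ℕ) (G : ℂ → ℂ), AnalyticOnNhd ℂ G (closedBall c R) →
      ∀ᶠ ρ : ℝ in 𝓝[>] 0, (∮ z in C(w, ρ), (z - w) ^ (-n : ℤ) * G z)
        = ∮ z in C(c, R), (z - w) ^ (-n : ℤ) * G z := by
    have hsub : ∀ᶠ ρ : ℝ in 𝓝[>] 0, closedBall w ρ ⊆ ball c R := by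
      have hd : 0 < R - dist w c := sub_pos.2 hw
      filter_upwards [Ioo_mem_nhdsGT hd] with ρ hρ z hz
      rw [mem_closedBall] at hz
      rw [mem_ball]
      linarith [dist_triangle z w c, hρ.2]
    have hne : ∀ {c' : ℂ} {ρ : ℝ}, w ∈ ball c' ρ → ∀ z ∈ sphere c' ρ, z - w ≠ 0 := by
      intro c' ρ h z hz h0
      rw [← sub_eq_zero.1 h0, mem_ball, mem_sphere.1 hz] at h
      exact lt_irrefl _ h
    intro n
    induction n with
    | zero =>
      intro G hG
      filter_upwards [hsub, self_mem_nhdsWithin] with ρ h1 h2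
      simp only [CharP.cast_eq_zero, neg_zero, zpow_zero, one_mul]
      rw [DiffContOnCl.circleIntegral_eq_zero (le_of_lt h2), DiffContOnCl.circleIntegral_eq_zero
        hR.le]
      · exact DifferentiableOn.diffContOnCl_ball hG.differentiableOn subset_rfl
      · exact DifferentiableOn.diffContOnCl_ball
          (hG.mono (h1.trans ball_subset_closedBall)).differentiableOn subset_rfl
    | succ n ih =>
      intro G hG
      have hGs : AnalyticOnNhd ℂ (dslope G w) (closedBall c R) := by
        have hU := isOpen_analyticAt ℂ G
        have hwU : {z | AnalyticAt ℂ G z} ∈ 𝓝 w := hU.mem_nhds (hG w (ball_subset_closedBall hw))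
        have hdiff : DifferentiableOn ℂ (dslope G w) {z | AnalyticAt ℂ G z} :=
          (Complex.differentiableOn_dslope hwU).2 fun z hz =>
            (AnalyticAt.differentiableAt hz).differentiableWithinAt
        exact fun z hz => hdiff.analyticAt (hU.mem_nhds (hG z hz))
      have expand : ∀ (c' : ℂ) (ρ : ℝ), 0 ≤ ρ → w ∈ ball c' ρ →
          closedBall c' ρ ⊆ closedBall c R →
          (∮ z in C(c', ρ), (z - w) ^ (-(n + 1 : ℕ) : ℤ) * G z) =
            G w * (∮ z in C(c', ρ), (z - w) ^ (-(n + 1 : ℕ) : ℤ)) +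
              ∮ z in C(c', ρ), (z - w) ^ (-n : ℤ) * dslope G w z := by
        intro c' ρ hρ hwρ hs
        have hz : ∀ k : ℤ, ContinuousOn (fun z => (z - w) ^ k) (sphere c' ρ) := fun k =>
          ContinuousOn.zpow₀ (by fun_prop) k fun z hz => Or.inl (hne hwρ z hz)
        rw [← circleIntegral.integral_const_mul, ← circleIntegral.integral_add]
        · refine circleIntegral.integral_congr hρ fun z hz => ?_
          have h0 := hne hwρ z hz
          have h1 := sub_smul_dslope G w z
          simp only [smul_eq_mul] at h1
          have h2 : (z - w) ^ (-n : ℤ) = (z - w) ^ (-(n + 1 : ℕ) : ℤ) * (z - w) := by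
            rw [← zpow_add_one₀ h0]; congr 1; push_cast; ring
          simp only [h2]
          linear_combination (-(z - w) ^ (-(n + 1 : ℕ) : ℤ)) * h1
        · exact (continuousOn_const.mul (hz _)).circleIntegrable hρ
        · exact ((hz _).mul (hGs.continuousOn.mono
            (sphere_subset_closedBall.trans hs))).circleIntegrable hρ
      filter_upwards [hsub, self_mem_nhdsWithin, ih _ hGs] with ρ h1 h2 h3
      have h2 : 0 < ρ := h2
      rw [expand w ρ h2.le (mem_ball_self h2) (h1.trans ball_subset_closedBall),
        expand c R hR.le hw subset_rfl, h3]
      congr 2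
      rcases Nat.eq_zero_or_pos n with rfl | hn0
      · have := circleIntegral.integral_sub_inv_of_mem_ball hw
        have h' := circleIntegral.integral_sub_inv_of_mem_ball (mem_ball_self (x := w) h2)
        simpa using h'.trans this.symm
      · rw [circleIntegral.integral_sub_zpow_of_ne, circleIntegral.integral_sub_zpow_of_ne] <;>
        · push_cast; omega
  refine tendsto_const_nhds.congr' ?_
  filter_upwards [key n G hG, self_mem_nhdsWithin] with ρ hρ hρ0
  have hback : ∀ z, z ≠ w → (z - w) ^ (-n : ℤ) * G z = f z := by
    intro z hz
    have : z - w ≠ 0 := sub_ne_zero.2 hz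
    simp only [hGdef, smul_eq_mul, zpow_neg, zpow_natCast]
    field_simp
  congr 1
  rw [circleIntegral.integral_congr hR.le (g := fun z => (z - w) ^ (-n : ℤ) * G z), ← hρ,
    circleIntegral.integral_congr (le_of_lt hρ0)]
  · intro z hz
    refine hback z ?_
    rintro rfl
    rw [mem_sphere, dist_self] at hz
    exact (ne_of_lt hρ0) hz
  · intro z hz
    refine (hback z ?_).symm
    rintro rfl
    rw [mem_ball, mem_sphere.1 hz] at hw
    exact lt_irrefl _ hw

theorem hasResidue_zero_of_order_nonneg (hf : MeromorphicAt f w)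
    (h0 : 0 ≤ meromorphicOrderAt f w) : HasResidue f w 0 := by
  obtain ⟨g, hg, hfg⟩ := hf.meromorphicOrderAt_nonneg_iff.1 h0
  refine HasResidue.congr ?_ hfg.symm
  obtain ⟨ε, hε, h⟩ := Metric.eventually_nhds_iff_ball.1 hg.eventually_analyticAt
  refine tendsto_const_nhds.congr' ?_
  filter_upwards [Ioo_mem_nhdsGT hε] with ρ hρ
  rw [DiffContOnCl.circleIntegral_eq_zero hρ.1.le, mul_zero]
  exact DifferentiableOn.diffContOnCl_ball (U := closedBall w ρ)
    (fun z hz => (h z (closedBall_subset_ball hρ.2 hz)).differentiableAt.differentiableWithinAt)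
    subset_rfl

theorem residueInfty_eq_zero (h0 : Tendsto (fun z => z * f z) (cocompact ℂ) (𝓝 0)) :
    residueInfty f = 0 := by
  refine Tendsto.limUnder_eq ?_
  rw [Metric.tendsto_nhds]
  intro ε hε
  rw [Metric.tendsto_nhds] at h0
  have h1 := h0 (ε / 2) (by positivity)
  rw [← Metric.cobounded_eq_cocompact, Filter.hasBasis_cobounded_norm.eventually_iff] at h1
  obtain ⟨r, -, hr⟩ := h1
  filter_upwards [eventually_ge_atTop r, eventually_gt_atTop 0] with R hR hR0
  have hb : ∀ z ∈ sphere (0 : ℂ) R, ‖f z‖ ≤ ε / 2 / R := by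
    intro z hz
    have hz : ‖z‖ = R := by simpa using hz
    have := hr (show r ≤ ‖z‖ by rw [hz]; exact hR)
    rw [dist_zero_right, norm_mul, hz] at this
    rw [le_div_iff₀ hR0, mul_comm]
    exact this.le
  have := circleIntegral.norm_two_pi_i_inv_smul_integral_le_of_norm_le_const hR0.le hb
  rw [smul_eq_mul, mul_div_cancel₀ _ hR0.ne'] at this
  rw [dist_zero_right, norm_neg]
  linarith

end Residue

end Whitham

/-! ### Differentiation of the densities along curves -/

namespace Whitham

open Metric Set

variable {m : ℕ}

/-- On a compact set uniform convergence to a continuous limit is a joint limit in the parameter and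
the point, to which the algebra of limits applies. -/
theorem tendstoUniformlyOn_iff_forall_tendsto {F : ℂ → ℂ → ℂ} {f : ℂ → ℂ} {l : Filter ℂ}
    {K : Set ℂ} (hK : IsCompact K) (hf : ContinuousOn f K) :
    TendstoUniformlyOn F f l K ↔
      ∀ x ∈ K, Tendsto (fun y : ℂ × ℂ => F y.1 y.2) (l ×ˢ 𝓝[K] x) (𝓝 (f x)) := by
  rw [← tendstoLocallyUniformlyOn_iff_tendstoUniformlyOn_of_compact hK,
    tendstoLocallyUniformlyOn_iff_forall_tendsto]
  refine forall₂_congr fun x hx => ?_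
  have hfx : Tendsto (fun y : ℂ × ℂ => f y.2) (l ×ˢ 𝓝[K] x) (𝓝 (f x)) :=
    Tendsto.comp (hf x hx) tendsto_snd
  rw [tendsto_uniformity_iff_dist_tendsto_zero]
  refine ⟨fun h => hfx.congr_dist h, fun h => ?_⟩
  simpa using hfx.dist h

/-- Differentiation of the circle integral of a power along a uniformly differentiable family. -/
theorem hasDerivAt_circleIntegral_pow {g : ℂ → ℂ → ℂ} {X : ℂ → ℂ} {c : ℂ} {R : ℝ} (hR : 0 ≤ R)
    (hg : ∀ s, ContinuousOn (g s) (sphere c R))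
    (h : TendstoUniformlyOn (fun s z => (g s z - g 0 z) / s) X (𝓝[≠] (0 : ℂ)) (sphere c R))
    (n : ℕ) :
    HasDerivAt (fun s => ∮ z in C(c, R), g s z ^ (n + 1))
      (∮ z in C(c, R), (n + 1) * g 0 z ^ n * X z) 0 := by
  have hK := isCompact_sphere c R
  have hX : ContinuousOn X (sphere c R) :=
    h.continuousOn (Eventually.frequently (Eventually.of_forall fun s =>
      ((hg s).sub (hg 0)).div_const s))
  rw [tendstoUniformlyOn_iff_forall_tendsto hK hX] at h
  have hslope : TendstoUniformlyOn (fun s z => (g s z ^ (n + 1) - g 0 z ^ (n + 1)) / s)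
      (fun z => (n + 1) * g 0 z ^ n * X z) (𝓝[≠] (0 : ℂ)) (sphere c R) := by
    rw [tendstoUniformlyOn_iff_forall_tendsto hK (by fun_prop (disch := assumption))]
    intro x hx
    have hs : Tendsto (fun y : ℂ × ℂ => y.1) (𝓝[≠] (0 : ℂ) ×ˢ 𝓝[sphere c R] x) (𝓝 0) :=
      tendsto_fst.mono_right nhdsWithin_le_nhds
    have h0 : Tendsto (fun y : ℂ × ℂ => g 0 y.2) (𝓝[≠] (0 : ℂ) ×ˢ 𝓝[sphere c R] x)
        (𝓝 (g 0 x)) := Tendsto.comp (hg 0 x hx) tendsto_snd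
    have hne : ∀ᶠ y : ℂ × ℂ in 𝓝[≠] (0 : ℂ) ×ˢ 𝓝[sphere c R] x, y.1 ≠ 0 :=
      tendsto_fst.eventually self_mem_nhdsWithin
    have h1 : Tendsto (fun y : ℂ × ℂ => g y.1 y.2) (𝓝[≠] (0 : ℂ) ×ˢ 𝓝[sphere c R] x)
        (𝓝 (g 0 x)) := by
      have := h0.add (hs.mul (h x hx))
      rw [zero_mul, add_zero] at this
      refine this.congr' ?_
      filter_upwards [hne] with y hy
      field_simp
      ring
    -- This geometric sum times `g s - g 0` is `g s ^ (n + 1) - g 0 ^ (n + 1)`; each of its `n + 1`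
    -- terms tends to `g 0 ^ n`.
    have hsum : Tendsto (fun y : ℂ × ℂ => ∑ i ∈ Finset.range (n + 1),
        g y.1 y.2 ^ i * g 0 y.2 ^ (n + 1 - 1 - i)) (𝓝[≠] (0 : ℂ) ×ˢ 𝓝[sphere c R] x)
        (𝓝 (∑ i ∈ Finset.range (n + 1), g 0 x ^ i * g 0 x ^ (n + 1 - 1 - i))) :=
      tendsto_finsetSum _ fun i _ => (h1.pow i).mul (h0.pow _)
    have hlim : ∑ i ∈ Finset.range (n + 1), g 0 x ^ i * g 0 x ^ (n + 1 - 1 - i)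
        = (n + 1) * g 0 x ^ n := by
      rw [Finset.sum_congr rfl fun i hi => ?_, Finset.sum_const, Finset.card_range, nsmul_eq_mul]
      · push_cast; rfl
      · rw [← pow_add]
        congr 1
        have := Finset.mem_range.1 hi
        omega
    rw [hlim] at hsum
    refine (hsum.mul (h x hx)).congr fun y => ?_
    rw [← mul_div_assoc, (Commute.all (g y.1 y.2) (g 0 y.2)).geom_sum₂_mul]
  have hpow : ∀ s, ContinuousOn (fun z => g s z ^ (n + 1)) (sphere c R) := fun s => (hg s).pow _
  rw [hasDerivAt_iff_tendsto_slope]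
  refine (hslope.tendsto_circleIntegral_of_continuousOn hR (Eventually.of_forall fun s =>
    ContinuousOn.div_const ((hpow s).sub (hpow 0)) s)).congr fun s => ?_
  rw [slope_def_field, ← circleIntegral.integral_sub ((hpow s).circleIntegrable hR)
    ((hpow 0).circleIntegrable hR), sub_zero, div_eq_inv_mul,
    ← circleIntegral.integral_const_mul]
  exact circleIntegral.integral_congr hR fun z _ => div_eq_inv_mul _ _

namespace Point

variable {D : DiskConfig m} (P : Point D)

theorem φ_mem_interiorDomain (j : Fin m) : P.φ j ∈ D.interiorDomain :=
  D.closedBall_subset_interiorDomain j (ball_subset_closedBall (P.φ_mem j))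

theorem eq_of_φ_mem {j k : Fin m} (h : P.φ k ∈ closedBall (D.center j) (D.radius j)) : k = j :=
  D.eq_of_mem_closedBall (ball_subset_closedBall (P.φ_mem k)) h

theorem φ_notMem_exteriorDomain (j : Fin m) : P.φ j ∉ D.exteriorDomain :=
  fun h => h (mem_iUnion.2 ⟨j, P.φ_mem j⟩)

theorem contour_subset_diff : D.contour ⊆ D.interiorDomain \ range P.φ := by
  refine fun z hz => ⟨D.contour_subset_interiorDomain hz, ?_⟩
  rintro ⟨j, rfl⟩
  exact P.φ_notMem_exteriorDomain j (D.contour_subset_exteriorDomain hz)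

theorem closedBall_diff_subset (j : Fin m) :
    closedBall (D.center j) (D.radius j) \ {P.φ j} ⊆ D.interiorDomain \ range P.φ := by
  rintro z ⟨hz, hne⟩
  refine ⟨D.closedBall_subset_interiorDomain j hz, ?_⟩
  rintro ⟨k, rfl⟩
  obtain rfl := P.eq_of_φ_mem hz
  exact hne rfl

theorem a_analytic_contour : AnalyticOnNhd ℂ P.a D.contour :=
  P.a_analytic.mono D.contour_subset_exteriorDomain

theorem aHat_analytic_contour : AnalyticOnNhd ℂ P.aHat D.contour :=
  P.aHat_analytic.mono P.contour_subset_diff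

theorem meromorphicAt_aHat (j : Fin m) : MeromorphicAt P.aHat (P.φ j) :=
  meromorphicAt_of_meromorphicOrderAt_ne_zero (by rw [P.aHat_pole j]; decide)

theorem hasResidue_contourInt {f : ℂ → ℂ} (hf : AnalyticOnNhd ℂ f (D.interiorDomain \ range P.φ))
    {j : Fin m} (hfm : MeromorphicAt f (P.φ j)) : HasResidue f (P.φ j) (D.contourInt j f) :=
  hasResidue_of_analyticOnNhd (P.φ_mem j) (hf.mono (P.closedBall_diff_subset j)) hfm

/-- The pole `φ_k` is the only singularity in `D_k`. On the contour the density depends only on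
values that `HasVelocity` controls, although `φ_k` moves along a curve. -/
theorem thetaH_eq (k : Fin m) (p : ℕ) :
    P.thetaH k p = ((p + 1).factorial : ℂ)⁻¹ * D.contourInt k fun z => P.aHat z ^ (p + 1) := by
  have h : HasResidue (fun z => P.aHat z ^ (p + 1)) (P.φ k) _ :=
    P.hasResidue_contourInt (P.aHat_analytic.pow (p + 1)) ((P.meromorphicAt_aHat k).pow (p + 1))
  rw [thetaH, h.residue_eq]
  rfl

/-- The powers of `â` in `θ_{t_{k,0},p}` and `θ_{h_{k,0},p}` cancel. -/
theorem theta_e_eq (p : ℕ) :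
    theta .e p P = ∑ k, ((p + 1).factorial : ℂ)⁻¹ * D.contourInt k fun z => P.a z ^ (p + 1) := by
  simp only [theta]
  refine Finset.sum_congr rfl fun k _ => ?_
  have h1 : CircleIntegrable (fun z => P.a z ^ (p + 1)) (D.center k) (D.radius k) :=
    DiskConfig.circleIntegrable_of_continuousOn_contour
      (P.a_analytic_contour.continuousOn.pow (p + 1)) k
  have h2 : CircleIntegrable (fun z => P.aHat z ^ (p + 1)) (D.center k) (D.radius k) :=
    DiskConfig.circleIntegrable_of_continuousOn_contour
      (P.aHat_analytic_contour.continuousOn.pow (p + 1)) k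
  rw [thetaH_eq, thetaT, ← mul_add, DiskConfig.contourInt, DiskConfig.contourInt,
    DiskConfig.contourInt, circleIntegral.integral_sub h1 h2]
  ring

end Point

section Derivative

variable {D : DiskConfig m}

theorem factorial_succ_inv_mul (p : ℕ) (z : ℂ) :
    ((p + 1).factorial : ℂ)⁻¹ * ((p + 1) * z) = (p.factorial : ℂ)⁻¹ * z := by
  rw [Nat.factorial_succ]
  push_cast
  have h1 : (p : ℂ) + 1 ≠ 0 := by exact_mod_cast p.succ_ne_zero
  have h2 : (p.factorial : ℂ) ≠ 0 := by exact_mod_cast p.factorial_ne_zero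
  field_simp

/-- The powers that generate the densities of the sector: `Q_{α,p-1} / p!`. -/
noncomputable def density (P : Point D) : Sector m → ℕ → ℂ → ℂ
  | .h k, p => fun z => (p.factorial : ℂ)⁻¹ * P.aHat z ^ p * D.charFun k z
  | .e, p => fun z => (p.factorial : ℂ)⁻¹ * P.a z ^ p * ∑ k, D.charFun k z

/-- The component of a tangent vector that enters the derivative of the densities. -/
def component : Sector m → (ℂ → ℂ) × (ℂ → ℂ) → ℂ → ℂ
  | .h _, X => X.2
  | .e, X => X.1

theorem hasDerivAt_theta_curve (α : Sector m) (p : ℕ) (c : ℂ → Point D)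
    {X : (ℂ → ℂ) × (ℂ → ℂ)} (hc : HasVelocity c X) :
    HasDerivAt (fun s => theta α p (c s))
      (D.totalInt fun z => density (c 0) α p z * component α X z) 0 := by
  have key : ∀ (g : ℂ → ℂ → ℂ) (Y : ℂ → ℂ) (k : Fin m), (∀ s, ContinuousOn (g s) D.contour) →
      TendstoUniformlyOn (fun s z => (g s z - g 0 z) / s) Y (𝓝[≠] (0 : ℂ)) D.contour →
      HasDerivAt (fun s => ((p + 1).factorial : ℂ)⁻¹ * D.contourInt k fun z => g s z ^ (p + 1))
        (D.contourInt k fun z => (p.factorial : ℂ)⁻¹ * g 0 z ^ p * Y z) 0 := by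
    intro g Y k hg hY
    have h := (((hasDerivAt_circleIntegral_pow (D.radius_pos k).le
      (fun s => (hg s).mono (D.sphere_subset_contour k))
      (hY.mono (D.sphere_subset_contour k)) p).const_mul
      (2 * Real.pi * Complex.I : ℂ)⁻¹).const_mul ((p + 1).factorial : ℂ)⁻¹)
    refine h.congr_deriv ?_
    have h1 : ∀ z, (p.factorial : ℂ)⁻¹ * g 0 z ^ p * Y z
        = (p.factorial : ℂ)⁻¹ * (g 0 z ^ p * Y z) := fun z => by ring
    have h2 : ∀ z, ((p : ℂ) + 1) * g 0 z ^ p * Y z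
        = (p + 1) * (g 0 z ^ p * Y z) := fun z => by ring
    simp only [DiskConfig.contourInt, h1, h2, circleIntegral.integral_const_mul]
    linear_combination factorial_succ_inv_mul p ((2 * Real.pi * Complex.I : ℂ)⁻¹ *
      ∮ z in C(D.center k, D.radius k), g 0 z ^ p * Y z)
  cases α with
  | h k =>
    have h := key (fun s => (c s).aHat) X.2 k
      (fun s => (c s).aHat_analytic_contour.continuousOn) hc.2
    simp only [theta, Point.thetaH_eq]
    refine h.congr_deriv ?_
    rw [← DiskConfig.totalInt_mul_charFun]
    refine DiskConfig.totalInt_congr fun z _ => ?_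
    simp only [density, component]
    ring
  | e =>
    simp only [Point.theta_e_eq]
    have h := HasDerivAt.fun_sum fun k (_ : k ∈ Finset.univ) => key (fun s => (c s).a) X.1 k
      (fun s => (c s).a_analytic_contour.continuousOn) hc.1
    refine h.congr_deriv ?_
    change D.totalInt _ = _
    refine DiskConfig.totalInt_congr fun z hz => ?_
    simp only [density, component,
      (D.sum_charFun_eventuallyEq (D.contour_subset_interiorDomain hz)).self_of_nhds]
    ring

end Derivative

end Whitham

/-! ### Every tangent vector is a velocity -/

namespace Whitham

open Metric Set

variable {m : ℕ}

theorem exists_analyticAt_update {f : ℂ → ℂ} {w : ℂ} (hf : MeromorphicAt f w)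
    (h0 : 0 ≤ meromorphicOrderAt f w) : ∃ v, AnalyticAt ℂ (Function.update f w v) w := by
  obtain ⟨g, hg, hfg⟩ := hf.meromorphicOrderAt_nonneg_iff.1 h0
  refine ⟨g w, hg.congr ?_⟩
  filter_upwards [eventually_nhdsWithin_iff.1 hfg] with z hz
  by_cases h : z = w
  · simp [h]
  · simp [h, hz h]

theorem _root_.AnalyticAt.update_of_ne {f : ℂ → ℂ} {z w : ℂ} (hf : AnalyticAt ℂ f z) (h : z ≠ w)
    (v : ℂ) : AnalyticAt ℂ (Function.update f w v) z := by
  refine hf.congr ?_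
  filter_upwards [isOpen_ne.mem_nhds h] with y hy
  simp [Function.update_of_ne hy]

theorem analyticOnNhd_dslope {f : ℂ → ℂ} {s : Set ℂ} {w : ℂ} (hf : AnalyticOnNhd ℂ f s)
    (hw : w ∈ s) : AnalyticOnNhd ℂ (dslope f w) s := by
  have hU := isOpen_analyticAt ℂ f
  have hdiff : DifferentiableOn ℂ (dslope f w) {z | AnalyticAt ℂ f z} :=
    (Complex.differentiableOn_dslope (hU.mem_nhds (hf w hw))).2 fun z hz =>
      (AnalyticAt.differentiableAt hz).differentiableWithinAt
  exact fun z hz => hdiff.analyticAt (hU.mem_nhds (hf z hz))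

namespace DiskConfig

variable (D : DiskConfig m)

/-- The function that is `f j` near the disk `D_j`. -/
noncomputable def glue (f : Fin m → ℂ → ℂ) (z : ℂ) : ℂ := ∑ j, D.charFun j z * f j z

theorem glue_eventuallyEq (f : Fin m → ℂ → ℂ) {z : ℂ} {j : Fin m}
    (hz : z ∈ closedBall (D.center j) (D.radius j)) : D.glue f =ᶠ[𝓝 z] f j := by
  filter_upwards [eventually_all.2 fun k => D.charFun_eventuallyEq hz k] with w hw
  simp [glue, hw]

end DiskConfig

namespace Point

variable {D : DiskConfig m} (P : Point D)

/-- `â = n / (z - φ_j)` on `D_j`, with `n` analytic and without zeros. -/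
theorem exists_numerator (j : Fin m) : ∃ n : ℂ → ℂ,
    AnalyticOnNhd ℂ n (closedBall (D.center j) (D.radius j)) ∧
    (∀ z ∈ closedBall (D.center j) (D.radius j), n z ≠ 0) ∧
    ∀ z, z ≠ P.φ j → n z = (z - P.φ j) * P.aHat z := by
  have hid : MeromorphicAt (fun z => z - P.φ j) (P.φ j) := by fun_prop
  have hm : MeromorphicAt (fun z => (z - P.φ j) * P.aHat z) (P.φ j) :=
    hid.mul (P.meromorphicAt_aHat j)
  have hord : meromorphicOrderAt (fun z => (z - P.φ j) * P.aHat z) (P.φ j) = 0 := by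
    have := meromorphicOrderAt_mul hid (P.meromorphicAt_aHat j)
    rw [P.aHat_pole j] at this
    have h1 : meromorphicOrderAt (fun z => z - P.φ j) (P.φ j) = 1 :=
      meromorphicOrderAt_id_sub_const
    rw [h1] at this
    exact this
  obtain ⟨v, hv⟩ := exists_analyticAt_update hm hord.ge
  have hne : ∀ z, z ≠ P.φ j → Function.update (fun z => (z - P.φ j) * P.aHat z) (P.φ j) v z
      = (z - P.φ j) * P.aHat z := fun z hz => by simp [Function.update_of_ne hz]
  refine ⟨_, fun z hz => ?_, fun z hz => ?_, hne⟩
  · by_cases h : z = P.φ j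
    · exact h ▸ hv
    · refine AnalyticAt.update_of_ne ?_ h v
      exact (analyticAt_id.sub analyticAt_const).mul
        (P.aHat_analytic z (P.closedBall_diff_subset j ⟨hz, h⟩))
  · by_cases h : z = P.φ j
    · rw [h, ← hv.analyticOrderAt_eq_zero]
      have h1 : meromorphicOrderAt (Function.update (fun z => (z - P.φ j) * P.aHat z) (P.φ j) v)
          (P.φ j) = 0 := by
        rw [← hord]
        refine meromorphicOrderAt_congr ?_
        filter_upwards [self_mem_nhdsWithin] with z hz
        exact hne z hz
      rw [hv.meromorphicOrderAt_eq] at h1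
      cases h2 : analyticOrderAt (Function.update (fun z => (z - P.φ j) * P.aHat z) (P.φ j) v)
        (P.φ j) with
      | top => simp [h2] at h1
      | coe k => simpa [h2] using h1
    · rw [hne z h]
      exact mul_ne_zero (sub_ne_zero.2 h)
        (P.aHat_ne_zero z (P.closedBall_diff_subset j ⟨hz, h⟩))

/-- A double pole of `∂_X â` means that `φ_j` moves, with speed `v`. Writing `â = n / (z - φ_j)`,
the speed is fixed by requiring that the variation `k = (z - φ_j) ∂_X â - v â` of the numerator be
regular at `φ_j`: this makes `(z - φ_j)² ∂_X â - v n` vanish there. -/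
theorem exists_numerator_variation {X : (ℂ → ℂ) × (ℂ → ℂ)} (hX : P.IsTangent X) (j : Fin m) :
    ∃ (n k : ℂ → ℂ) (v : ℂ),
      AnalyticOnNhd ℂ n (closedBall (D.center j) (D.radius j)) ∧
      AnalyticOnNhd ℂ k (closedBall (D.center j) (D.radius j)) ∧
      (∀ z ∈ closedBall (D.center j) (D.radius j), n z ≠ 0) ∧
      ∀ z, z ≠ P.φ j → n z = (z - P.φ j) * P.aHat z ∧
        k z = (z - P.φ j) * X.2 z - v * P.aHat z := by
  obtain ⟨n, hn, hn0, hne⟩ := P.exists_numerator j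
  have hφ : P.φ j ∈ closedBall (D.center j) (D.radius j) := ball_subset_closedBall (P.φ_mem j)
  obtain ⟨hXm, hXo⟩ := hX.2.2.2 j
  have hid : MeromorphicAt (fun z => (z - P.φ j) ^ 2) (P.φ j) := by fun_prop
  have hm : MeromorphicAt (fun z => (z - P.φ j) ^ 2 * X.2 z) (P.φ j) := hid.mul hXm
  have hord : 0 ≤ meromorphicOrderAt (fun z => (z - P.φ j) ^ 2 * X.2 z) (P.φ j) := by
    have h1 : meromorphicOrderAt (fun z => (z - P.φ j) ^ 2) (P.φ j) = 2 := by
      simpa using! fun_meromorphicOrderAt_pow_id_sub_const (n := 2) (x := P.φ j)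
    have h2 := meromorphicOrderAt_mul hid hXm
    rw [h1] at h2
    change 0 ≤ meromorphicOrderAt ((fun z => (z - P.φ j) ^ 2) * X.2) (P.φ j)
    rw [h2]
    calc (0 : WithTop ℤ) = 2 + -2 := by decide
      _ ≤ _ := by gcongr
  obtain ⟨v0, hv0⟩ := exists_analyticAt_update hm hord
  set M := Function.update (fun z => (z - P.φ j) ^ 2 * X.2 z) (P.φ j) v0 with hMdef
  have hM : AnalyticOnNhd ℂ M (closedBall (D.center j) (D.radius j)) := by
    intro z hz
    by_cases h : z = P.φ j
    · exact h ▸ hv0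
    · refine AnalyticAt.update_of_ne ?_ h v0
      exact ((analyticAt_id.sub analyticAt_const).pow 2).mul
        (hX.2.2.1 z (P.closedBall_diff_subset j ⟨hz, h⟩))
  set v := M (P.φ j) / n (P.φ j) with hv
  set L : ℂ → ℂ := fun z => M z - v * n z with hL
  have hLan : AnalyticOnNhd ℂ L (closedBall (D.center j) (D.radius j)) :=
    hM.sub (analyticOnNhd_const.mul hn)
  have hL0 : L (P.φ j) = 0 := by
    simp only [hL, hv]
    rw [div_mul_cancel₀ _ (hn0 _ hφ), sub_self]
  refine ⟨n, dslope L (P.φ j), v, hn, analyticOnNhd_dslope hLan hφ, hn0, fun z hz =>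
    ⟨hne z hz, ?_⟩⟩
  have hz' : z - P.φ j ≠ 0 := sub_ne_zero.2 hz
  rw [dslope_of_ne _ hz, slope_def_field, hL0]
  simp only [hL, hMdef, Function.update_of_ne hz, hne z hz]
  field_simp
  ring

/-- The exterior domain is not compact: near infinity `|a| > 1 > |∂_X a|` suffices for `|s| < 1`,
and on the remaining compact part continuity in `s` does. -/
theorem a_add_mul_ne_zero {X : (ℂ → ℂ) × (ℂ → ℂ)} (hX : P.IsTangent X) :
    ∀ᶠ s in 𝓝 (0 : ℂ), ∀ z ∈ D.exteriorDomain, P.a z + s * X.1 z ≠ 0 := by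
  have hA : ∀ᶠ z in cocompact ℂ, 1 < ‖P.a z‖ := by
    have h1 : ∀ᶠ z in cocompact ℂ, ‖P.a z - z‖ < 1 := by
      have := P.a_infty.norm
      rw [norm_zero] at this
      exact this.eventually (gt_mem_nhds one_pos)
    have h2 : ∀ᶠ z : ℂ in cocompact ℂ, 2 < ‖z‖ :=
      (tendsto_norm_cocompact_atTop (E := ℂ)).eventually_gt_atTop 2
    filter_upwards [h1, h2] with z h1 h2
    have : ‖z‖ ≤ ‖P.a z‖ + ‖P.a z - z‖ := by
      have := norm_sub_le (P.a z) (P.a z - z)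
      simpa using this
    linarith
  have hB : ∀ᶠ z in cocompact ℂ, ‖X.1 z‖ < 1 := by
    have := hX.2.1.norm
    rw [norm_zero] at this
    exact this.eventually (gt_mem_nhds one_pos)
  obtain ⟨K, hK, hKs⟩ := mem_cocompact.1 (hA.and hB)
  have hext : IsClosed D.exteriorDomain :=
    (isOpen_iUnion fun _ => isOpen_ball).isClosed_compl
  have hcomp : ∀ᶠ s in 𝓝 (0 : ℂ), ∀ z ∈ K ∩ D.exteriorDomain, P.a z + s * X.1 z ≠ 0 := by
    refine (hK.inter_right hext).eventually_forall_of_forall_eventually fun z hz => ?_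
    have h1 : ContinuousAt (fun p : ℂ × ℂ => P.a p.2 + p.1 * X.1 p.2) (0, z) := by
      refine ContinuousAt.add ?_ (continuousAt_fst.mul ?_)
      · exact ContinuousAt.comp (f := Prod.snd) (x := ((0 : ℂ), z))
          (P.a_analytic z hz.2).continuousAt continuousAt_snd
      · exact ContinuousAt.comp (f := Prod.snd) (x := ((0 : ℂ), z))
          (hX.1 z hz.2).continuousAt continuousAt_snd
    exact h1.eventually_ne (by simpa using P.a_ne_zero z hz.2)
  filter_upwards [hcomp, ball_mem_nhds (0 : ℂ) one_pos] with s hs hs1 z hz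
  by_cases hzK : z ∈ K
  · exact hs z ⟨hzK, hz⟩
  · obtain ⟨h1, h2⟩ := hKs hzK
    intro h
    have hs1 : ‖s‖ < 1 := by simpa using hs1
    have : ‖P.a z‖ = ‖s‖ * ‖X.1 z‖ := by
      rw [← norm_mul, ← norm_neg (s * X.1 z), eq_neg_of_add_eq_zero_left h]
    have h3 : ‖s‖ * ‖X.1 z‖ ≤ 1 * 1 :=
      mul_le_mul hs1.le (le_of_lt h2) (norm_nonneg _) zero_le_one
    have h1 : 1 < ‖P.a z‖ := h1
    linarith

/-- The deformed pair is `a + s ∂_X a` and `(n + s k) / (z - φ_j - s v_j)` on `D_j`. The naive `â +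
s ∂_X â` would have a double pole; moving the pole keeps it simple. All open conditions survive for
small `s` by compactness. -/
theorem exists_deformation {X : (ℂ → ℂ) × (ℂ → ℂ)} (hX : P.IsTangent X) :
    ∃ v : Fin m → ℂ, ∀ᶠ s in 𝓝[≠] (0 : ℂ), ∃ P' : Point D,
      (∀ z, P'.a z = P.a z + s * X.1 z) ∧ ∀ j, ∀ z ∈ sphere (D.center j) (D.radius j),
        z - (P.φ j + s * v j) ≠ 0 ∧
        P'.aHat z = P.aHat z + s * ((z - P.φ j) * X.2 z / (z - (P.φ j + s * v j))) := by
  choose n k v hn hk hn0 hnk using P.exists_numerator_variation hX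
  refine ⟨v, ?_⟩
  have hball : ∀ j, ∀ᶠ s in 𝓝 (0 : ℂ), P.φ j + s * v j ∈ ball (D.center j) (D.radius j) := by
    intro j
    have : ContinuousAt (fun s : ℂ => P.φ j + s * v j) 0 := by fun_prop
    refine this.eventually (isOpen_ball.mem_nhds ?_)
    simpa using P.φ_mem j
  have hnum : ∀ j, ∀ᶠ s in 𝓝 (0 : ℂ), ∀ z ∈ closedBall (D.center j) (D.radius j),
      n j z + s * k j z ≠ 0 := by
    intro j
    refine (isCompact_closedBall _ _).eventually_forall_of_forall_eventually fun z hz => ?_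
    have h1 : ContinuousAt (fun p : ℂ × ℂ => n j p.2 + p.1 * k j p.2) (0, z) := by
      refine ContinuousAt.add ?_ (continuousAt_fst.mul ?_)
      · exact ContinuousAt.comp (f := Prod.snd) (x := ((0 : ℂ), z))
          (hn j z hz).continuousAt continuousAt_snd
      · exact ContinuousAt.comp (f := Prod.snd) (x := ((0 : ℂ), z))
          (hk j z hz).continuousAt continuousAt_snd
    exact h1.eventually_ne (by simpa using hn0 j z hz)
  -- The expression required to be nonzero is the derivative of the deformed `ζ`, written out
  -- through the data at `P`; at `s = 0` it is `ζ'`.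
  have hder : ∀ j, ∀ᶠ s in 𝓝 (0 : ℂ), ∀ z ∈ sphere (D.center j) (D.radius j),
      z - (P.φ j + s * v j) ≠ 0 → deriv P.a z + s * deriv X.1 z -
        (deriv P.aHat z + s * ((X.2 z + (z - P.φ j) * deriv X.2 z) * (z - (P.φ j + s * v j))
          - (z - P.φ j) * X.2 z) / (z - (P.φ j + s * v j)) ^ 2) ≠ 0 := by
    intro j
    refine (isCompact_sphere _ _).eventually_forall_of_forall_eventually fun z hz => ?_
    have hzc := D.sphere_subset_contour j hz
    have hze := D.contour_subset_exteriorDomain hzc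
    have hzd := P.contour_subset_diff hzc
    have snd : ∀ f : ℂ → ℂ, ContinuousAt f z → ContinuousAt (fun p : ℂ × ℂ => f p.2) (0, z) :=
      fun f hf => ContinuousAt.comp (f := Prod.snd) (x := ((0 : ℂ), z)) hf continuousAt_snd
    have hzφ : z - P.φ j ≠ 0 := sub_ne_zero.2 fun h => hzd.2 ⟨j, h.symm⟩
    have h1 := snd _ (P.a_analytic z hze).deriv.continuousAt
    have h2 := snd _ (hX.1 z hze).deriv.continuousAt
    have h3 := snd _ (P.aHat_analytic z hzd).deriv.continuousAt
    have h4 := snd _ (hX.2.2.1 z hzd).continuousAt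
    have h5 := snd _ (hX.2.2.1 z hzd).deriv.continuousAt
    have h6 : ContinuousAt (fun p : ℂ × ℂ => p.2 - (P.φ j + p.1 * v j)) (0, z) := by fun_prop
    have h7 : ContinuousAt (fun p : ℂ × ℂ => p.2 - P.φ j) (0, z) := by fun_prop
    have h8 := (h1.add (continuousAt_fst.mul h2)).sub (h3.add ((continuousAt_fst.mul
      (((h4.add (h7.mul h5)).mul h6).sub (h7.mul h4))).div (h6.pow 2) (by simpa using hzφ)))
    refine (h8.eventually_ne (y := 0) ?_).mono fun p hp _ => hp
    have h9 := P.zeta_deriv_ne_zero z hzc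
    rw [deriv_fun_sub (P.a_analytic z hze).differentiableAt
      (P.aHat_analytic z hzd).differentiableAt] at h9
    simpa using h9
  filter_upwards [self_mem_nhdsWithin, nhdsWithin_le_nhds (eventually_all.2 hball),
    nhdsWithin_le_nhds (eventually_all.2 hnum), nhdsWithin_le_nhds (eventually_all.2 hder),
    nhdsWithin_le_nhds (P.a_add_mul_ne_zero hX)] with s hs0 hs1 hs2 hs3 hs4
  set φ' : Fin m → ℂ := fun j => P.φ j + s * v j with hφ'
  set q : Fin m → ℂ → ℂ := fun j z => (n j z + s * k j z) / (z - φ' j) with hq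
  have hqan : ∀ j, ∀ z ∈ closedBall (D.center j) (D.radius j), z ≠ φ' j →
      AnalyticAt ℂ (q j) z := by
    intro j z hz hzφ
    exact ((hn j z hz).add (analyticAt_const.mul (hk j z hz))).div
      (analyticAt_id.sub analyticAt_const) (sub_ne_zero.2 hzφ)
  have hqeq : ∀ j z, z ≠ P.φ j → z ≠ φ' j →
      P.aHat z + s * ((z - P.φ j) * X.2 z / (z - φ' j)) = q j z := by
    intro j z h1 h2
    obtain ⟨h3, h4⟩ := hnk j z h1
    have h5 : z - φ' j ≠ 0 := sub_ne_zero.2 h2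
    simp only [hq, h3, h4]
    field_simp
    simp only [hφ']
    ring
  have hsphere : ∀ j, ∀ z ∈ sphere (D.center j) (D.radius j), z ≠ P.φ j ∧ z ≠ φ' j := by
    intro j z hz
    constructor <;> rintro rfl
    · exact absurd (mem_sphere.1 hz) (mem_ball.1 (P.φ_mem j)).ne
    · exact absurd (mem_sphere.1 hz) (mem_ball.1 (hs1 j)).ne
  have hcases : ∀ z ∈ D.interiorDomain \ range φ',
      ∃ j, z ∈ closedBall (D.center j) (D.radius j) ∧ z ≠ φ' j := by
    rintro z ⟨hz, hz'⟩
    obtain ⟨j, hj⟩ := mem_iUnion.1 hz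
    exact ⟨j, hj, fun h => hz' ⟨j, h.symm⟩⟩
  refine ⟨{
    a := fun z => P.a z + s * X.1 z
    aHat := D.glue q
    φ := φ'
    φ_mem := hs1
    a_analytic := fun z hz => (P.a_analytic z hz).add (analyticAt_const.mul (hX.1 z hz))
    a_infty := ?_
    aHat_analytic := ?_
    aHat_pole := ?_
    a_ne_zero := hs4
    aHat_ne_zero := ?_
    zeta_deriv_ne_zero := ?_ }, fun z => rfl, ?_⟩
  · have := P.a_infty.add (hX.2.1.const_mul s)
    rw [mul_zero, add_zero] at this
    exact this.congr fun z => by ring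
  · intro z hz
    obtain ⟨j, hj, hne⟩ := hcases z hz
    exact (hqan j z hj hne).congr (D.glue_eventuallyEq q hj).symm
  · intro j
    have hj := ball_subset_closedBall (hs1 j)
    rw [meromorphicOrderAt_congr ((D.glue_eventuallyEq q hj).filter_mono nhdsWithin_le_nhds)]
    have han : AnalyticAt ℂ (fun z => n j z + s * k j z) (φ' j) :=
      (hn j _ hj).add (analyticAt_const.mul (hk j _ hj))
    have hqm : MeromorphicAt (q j) (φ' j) :=
      han.meromorphicAt.div (by fun_prop : MeromorphicAt (fun z => z - φ' j) (φ' j))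
    refine (meromorphicOrderAt_eq_int_iff (n := -1) hqm).2 ⟨_, han, hs2 j _ hj, ?_⟩
    exact Eventually.of_forall fun z => by simp [hq, div_eq_inv_mul]
  · intro z hz
    obtain ⟨j, hj, hne⟩ := hcases z hz
    rw [(D.glue_eventuallyEq q hj).self_of_nhds]
    exact div_ne_zero (hs2 j z hj) (sub_ne_zero.2 hne)
  · intro z hz
    obtain ⟨j, hj⟩ := mem_iUnion.1 hz
    have hze := D.contour_subset_exteriorDomain hz
    have hzd := P.contour_subset_diff hz
    obtain ⟨hne1, hne2⟩ := hsphere j z hj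
    have hloc : D.glue q =ᶠ[𝓝 z] fun z => P.aHat z + s * ((z - P.φ j) * X.2 z / (z - φ' j)) := by
      filter_upwards [D.glue_eventuallyEq q (sphere_subset_closedBall hj),
        isOpen_ne.mem_nhds hne1, isOpen_ne.mem_nhds hne2] with w h1 h2 h3
      rw [h1, hqeq j w h2 h3]
    have hX1 := (hX.1 z hze).differentiableAt.hasDerivAt
    have hX2 := (hX.2.2.1 z hzd).differentiableAt.hasDerivAt
    have hd1 : HasDerivAt (D.glue q) _ z :=
      HasDerivAt.congr_of_eventuallyEq ((P.aHat_analytic z hzd).differentiableAt.hasDerivAt.add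
        (((((hasDerivAt_id z).sub_const (P.φ j)).mul hX2).div
          ((hasDerivAt_id z).sub_const (φ' j)) (sub_ne_zero.2 hne2)).const_mul s)) hloc
    have hd2 := ((P.a_analytic z hze).differentiableAt.hasDerivAt.add (hX1.const_mul s)).sub hd1
    have hd3 : deriv (fun w => P.a w + s * X.1 w - D.glue q w) z = _ := hd2.deriv
    rw [hd3]
    have := hs3 j z hj (sub_ne_zero.2 hne2)
    convert this using 2
    simp only [id, mul_div_assoc]
    simp [hφ']
  · intro j z hz
    obtain ⟨hne1, hne2⟩ := hsphere j z hz
    refine ⟨sub_ne_zero.2 hne2, ?_⟩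
    change D.glue q z = _
    rw [(D.glue_eventuallyEq q (sphere_subset_closedBall hz)).self_of_nhds]
    exact (hqeq j z hne1 hne2).symm

/-- Every tangent vector is the velocity of a curve. -/
theorem exists_curve {X : (ℂ → ℂ) × (ℂ → ℂ)} (hX : P.IsTangent X) :
    ∃ c : ℂ → Point D, c 0 = P ∧ HasVelocity c X := by
  classical
  obtain ⟨v, hv⟩ := P.exists_deformation hX
  set G : ℂ → Point D → Prop := fun s P' =>
    (∀ z, P'.a z = P.a z + s * X.1 z) ∧ ∀ j, ∀ z ∈ sphere (D.center j) (D.radius j),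
        z - (P.φ j + s * v j) ≠ 0 ∧
        P'.aHat z = P.aHat z + s * ((z - P.φ j) * X.2 z / (z - (P.φ j + s * v j))) with hG
  -- Outside the good parameters the curve is given the value `P`; apart from `c 0 = P` these values
  -- do not affect the velocity.
  set c : ℂ → Point D := fun s => if h : s ≠ 0 ∧ ∃ P', G s P' then h.2.choose else P with hc
  have hc0 : c 0 = P := by simp [hc]
  have hcs : ∀ᶠ s in 𝓝[≠] (0 : ℂ), s ≠ 0 ∧ G s (c s) := by
    filter_upwards [hv, self_mem_nhdsWithin] with s hs hs0
    have h : s ≠ 0 ∧ ∃ P', G s P' := ⟨hs0, hs⟩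
    refine ⟨hs0, ?_⟩
    simp only [hc, dif_pos h]
    exact h.2.choose_spec
  refine ⟨c, hc0, ?_, ?_⟩
  · intro u hu
    filter_upwards [hcs] with s hs z _
    have : ((c s).a z - (c 0).a z) / s = X.1 z := by
      have hs0 := hs.1
      rw [hc0, hs.2.1 z]
      field_simp
      ring
    rw [this]
    exact refl_mem_uniformity hu
  · have hXc : ContinuousOn X.2 D.contour :=
      (hX.2.2.1.mono P.contour_subset_diff).continuousOn
    rw [tendstoUniformlyOn_iff_forall_tendsto D.isCompact_contour hXc]
    intro x hx
    obtain ⟨j, hj⟩ := mem_iUnion.1 hx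
    have hxφ : x - P.φ j ≠ 0 :=
      sub_ne_zero.2 fun h => (P.contour_subset_diff hx).2 ⟨j, h.symm⟩
    have h1 : Tendsto (fun y : ℂ × ℂ => X.2 y.2) (𝓝[≠] (0 : ℂ) ×ˢ 𝓝[D.contour] x)
        (𝓝 (X.2 x)) := Tendsto.comp (hXc x hx) tendsto_snd
    have hs : Tendsto (fun y : ℂ × ℂ => y.1) (𝓝[≠] (0 : ℂ) ×ˢ 𝓝[D.contour] x) (𝓝 0) :=
      tendsto_fst.mono_right nhdsWithin_le_nhds
    have hz : Tendsto (fun y : ℂ × ℂ => y.2) (𝓝[≠] (0 : ℂ) ×ˢ 𝓝[D.contour] x) (𝓝 x) :=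
      tendsto_snd.mono_right nhdsWithin_le_nhds
    have h2 : Tendsto (fun y : ℂ × ℂ => (y.2 - P.φ j) * X.2 y.2 / (y.2 - (P.φ j + y.1 * v j)))
        (𝓝[≠] (0 : ℂ) ×ˢ 𝓝[D.contour] x)
        (𝓝 ((x - P.φ j) * X.2 x / (x - (P.φ j + 0 * v j)))) :=
      ((hz.sub_const _).mul h1).div (hz.sub ((hs.mul_const (v j)).const_add (P.φ j)))
        (by simpa using hxφ)
    have h3 : (x - P.φ j) * X.2 x / (x - (P.φ j + 0 * v j)) = X.2 x := by
      rw [zero_mul, add_zero]; field_simp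
    rw [h3] at h2
    refine h2.congr' ?_
    -- Points of the contour close to `x ∈ γ_j` lie on `γ_j` itself, so the formula for `â` with the
    -- index `j` applies to them.
    have hcell : ∀ᶠ y : ℂ × ℂ in 𝓝[≠] (0 : ℂ) ×ˢ 𝓝[D.contour] x,
        y.2 ∈ D.cell j ∩ D.contour := by
      refine tendsto_snd.eventually (inter_mem (nhdsWithin_le_nhds
        ((D.isOpen_cell j).mem_nhds (D.closedBall_subset_cell j (sphere_subset_closedBall hj))))
        self_mem_nhdsWithin)
    filter_upwards [tendsto_fst.eventually hcs, hcell] with y hy hyc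
    obtain ⟨i, hi⟩ := mem_iUnion.1 hyc.2
    have hij : i = j := by
      by_contra hne
      have h4 := hyc.1 i hne
      have h5 := D.closedBall_subset_cell i (sphere_subset_closedBall hi) j (Ne.symm hne)
      linarith
    subst hij
    have hy0 := hy.1
    rw [hc0, (hy.2.2 i y.2 hi).2, add_sub_cancel_left, mul_div_cancel_left₀ _ hy0]

theorem hasDirDeriv_theta {X : (ℂ → ℂ) × (ℂ → ℂ)} (hX : P.IsTangent X) (α : Sector m) (p : ℕ) :
    HasDirDeriv (theta α p) P X (D.totalInt fun z => density P α p z * component α X z) := by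
  refine ⟨P.exists_curve hX, ?_⟩
  rintro c rfl hc
  exact hasDerivAt_theta_curve α p c hc

/-- The existence of a curve, part of `HasDirDeriv`, is what makes the derivative determined. -/
theorem _root_.Whitham.HasDirDeriv.unique {F : Point D → ℂ} {X : (ℂ → ℂ) × (ℂ → ℂ)} {d d' : ℂ}
    {P : Point D} (h : HasDirDeriv F P X d) (h' : HasDirDeriv F P X d') : d = d' := by
  obtain ⟨c, hc, hv⟩ := h.1
  exact (h.2 c hc hv).unique (h'.2 c hc hv)

end Point

end Whitham

/-! ### The function `ℓ`, the metric, and tangent vectors adapted to it -/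

namespace Whitham

open Metric Set

variable {m : ℕ}

namespace DiskConfig

variable {D : DiskConfig m}

/-- Because `f = p + q` holds everywhere and not only near `γ`, the continuation `f - f_-` outside
`D^int` is `p` as well. -/
theorem IsSplitting.plusPart_apply {f p q : ℂ → ℂ} (h : D.IsSplitting f p q)
    (hf : ∀ z, f z = p z + q z) (z : ℂ) : D.plusPart f z = p z := by
  by_cases hz : z ∈ D.interiorDomain
  · exact h.plusPart_eq.self_of_nhdsSet hz
  · have h1 := h.minusPart_eq.self_of_nhdsSet (D.mem_exteriorDomain_of_notMem hz)
    have h2 := D.plusPart_add_minusPart f z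
    rw [h1, hf z] at h2
    exact add_right_cancel h2

theorem plusPart_eq_zero {f : ℂ → ℂ} (hf : AnalyticOnNhd ℂ f D.exteriorDomain)
    (h0 : Tendsto f (cocompact ℂ) (𝓝 0)) (z : ℂ) : D.plusPart f z = 0 :=
  IsSplitting.plusPart_apply (p := fun _ => 0) ⟨fun _ _ => analyticAt_const, hf, h0,
    Eventually.of_forall fun _ => (zero_add _).symm⟩ (fun _ => (zero_add _).symm) z

theorem minusPart_eq_sub (f : ℂ → ℂ) : D.minusPart f = fun z => f z - D.plusPart f z :=
  funext fun z => by rw [← D.plusPart_add_minusPart f z]; ring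

theorem plusPart_eq_sub (f : ℂ → ℂ) : D.plusPart f = fun z => f z - D.minusPart f z :=
  funext fun z => by rw [← D.plusPart_add_minusPart f z]; ring

end DiskConfig

namespace Point

open DiskConfig

variable {D : DiskConfig m} (P : Point D)

theorem isSplitting_a : D.IsSplitting P.a (fun z => z) fun z => P.a z - z :=
  ⟨fun _ _ => analyticAt_id, P.a_analytic.sub fun _ _ => analyticAt_id, P.a_infty,
    Eventually.of_forall fun z => by ring⟩

theorem ell_eq_exterior : P.ell = fun z => P.a z - D.minusPart P.a z + D.minusPart P.aHat z := by
  funext z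
  rw [ell, plusPart_eq_sub]

/-- On `D^int` the functions `ℓ` and `â` differ by an analytic function. Hence `ℓ` has the simple
poles of `â`, and `ℓ'` may be replaced by `â'` when it multiplies functions analytic on `D^int`. -/
theorem ell_eq_interior : P.ell = fun z => P.aHat z + (D.plusPart P.a z - D.plusPart P.aHat z) := by
  funext z
  rw [ell, minusPart_eq_sub]
  ring

theorem analyticOnNhd_plusPart_sub :
    AnalyticOnNhd ℂ (fun z => D.plusPart P.a z - D.plusPart P.aHat z) D.interiorDomain :=
  (analyticOnNhd_plusPart P.a_analytic_contour).sub
    (analyticOnNhd_plusPart P.aHat_analytic_contour)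

theorem analyticOnNhd_ell_exterior : AnalyticOnNhd ℂ P.ell D.exteriorDomain := by
  rw [ell_eq_exterior]
  exact (P.a_analytic.sub (analyticOnNhd_minusPart P.a_analytic_contour)).add
    (analyticOnNhd_minusPart P.aHat_analytic_contour)

theorem analyticOnNhd_ell_interior : AnalyticOnNhd ℂ P.ell (D.interiorDomain \ range P.φ) := by
  rw [ell_eq_interior]
  exact P.aHat_analytic.add (P.analyticOnNhd_plusPart_sub.mono sdiff_subset)

theorem analyticOnNhd_ell_contour : AnalyticOnNhd ℂ P.ell D.contour :=
  P.analyticOnNhd_ell_exterior.mono D.contour_subset_exteriorDomain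

theorem analyticOnNhd_zeta_contour : AnalyticOnNhd ℂ P.zeta D.contour :=
  P.a_analytic_contour.sub P.aHat_analytic_contour

theorem deriv_ell_eq {z : ℂ} (hz : z ∈ D.interiorDomain \ range P.φ) :
    deriv P.ell z
      = deriv P.aHat z + deriv (fun z => D.plusPart P.a z - D.plusPart P.aHat z) z := by
  rw [ell_eq_interior, deriv_fun_add (P.aHat_analytic z hz).differentiableAt
    (P.analyticOnNhd_plusPart_sub z hz.1).differentiableAt]

theorem deriv_zeta_eq {z : ℂ} (hz : z ∈ D.contour) :
    deriv P.zeta z = deriv P.a z - deriv P.aHat z :=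
  deriv_fun_sub (P.a_analytic_contour z hz).differentiableAt
    (P.aHat_analytic_contour z hz).differentiableAt

theorem tendsto_deriv_of_sub_id {f : ℂ → ℂ} (hf : AnalyticOnNhd ℂ f D.exteriorDomain)
    (h0 : Tendsto (fun z => f z - z) (cocompact ℂ) (𝓝 0)) :
    Tendsto (deriv f) (cocompact ℂ) (𝓝 1) := by
  have h1 := (tendsto_deriv_of_analyticOnNhd_exteriorDomain
    (hf.sub fun _ _ => analyticAt_id) h0).add_const 1
  rw [zero_add] at h1
  refine h1.congr' ?_
  filter_upwards [D.compl_interiorDomain_mem_cocompact] with z hz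
  have := (hf z (D.mem_exteriorDomain_of_notMem hz)).differentiableAt.hasDerivAt.sub
    (hasDerivAt_id z)
  rw [this.deriv]
  ring

theorem tendsto_deriv_a : Tendsto (deriv P.a) (cocompact ℂ) (𝓝 1) :=
  tendsto_deriv_of_sub_id P.a_analytic P.a_infty

theorem tendsto_deriv_ell : Tendsto (deriv P.ell) (cocompact ℂ) (𝓝 1) := by
  refine tendsto_deriv_of_sub_id P.analyticOnNhd_ell_exterior ?_
  have := (P.a_infty.sub (tendsto_minusPart P.a_analytic_contour)).add
    (tendsto_minusPart P.aHat_analytic_contour)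
  rw [sub_zero, add_zero] at this
  refine this.congr fun z => ?_
  rw [ell_eq_exterior]
  ring

theorem meromorphicOrderAt_ell (j : Fin m) : meromorphicOrderAt P.ell (P.φ j) = (-1 : ℤ) := by
  have h := P.analyticOnNhd_plusPart_sub (P.φ j) (P.φ_mem_interiorDomain j)
  rw [ell_eq_interior]
  refine (meromorphicOrderAt_add_eq_left_of_lt h.meromorphicAt ?_).trans (P.aHat_pole j)
  rw [P.aHat_pole j]
  exact lt_of_lt_of_le (by decide) h.meromorphicOrderAt_nonneg

theorem meromorphicOrderAt_deriv_ell (j : Fin m) :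
    meromorphicOrderAt (deriv P.ell) (P.φ j) = (-2 : ℤ) :=
  meromorphicOrderAt_deriv (n := -2) (by norm_num) (P.meromorphicOrderAt_ell j)

theorem meromorphicAt_deriv_ell (j : Fin m) : MeromorphicAt (deriv P.ell) (P.φ j) :=
  meromorphicAt_of_meromorphicOrderAt_ne_zero (by rw [P.meromorphicOrderAt_deriv_ell j]; decide)

variable {P} {X Y : (ℂ → ℂ) × (ℂ → ℂ)}

theorem IsTangent.analyticOnNhd_fst (hX : P.IsTangent X) : AnalyticOnNhd ℂ X.1 D.contour :=
  hX.1.mono D.contour_subset_exteriorDomain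

theorem IsTangent.analyticOnNhd_snd (hX : P.IsTangent X) : AnalyticOnNhd ℂ X.2 D.contour :=
  hX.2.2.1.mono P.contour_subset_diff

theorem IsTangent.dEll_eq (hX : P.IsTangent X) : dEll D X = D.minusPart X.2 := by
  funext z
  rw [dEll, plusPart_eq_zero hX.1 hX.2.1, zero_add]

theorem metric_comm (X Y : (ℂ → ℂ) × (ℂ → ℂ)) : P.metric X Y = P.metric Y X := by
  simp only [metric, mul_comm (dZeta X _), mul_comm (dEll D X _)]

variable (P) in
/-- The tangent vector `Y` with `∂_Y ζ = u ζ'` near `γ` and `∂_Y ℓ = (V ℓ')_-`. -/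
noncomputable def gradVec (u V : ℂ → ℂ) : (ℂ → ℂ) × (ℂ → ℂ) :=
  (fun z => D.minusPart (fun w => deriv P.zeta w * u w) z
      + D.minusPart (fun w => deriv P.ell w * V w) z,
    fun z => -D.plusPart (fun w => deriv P.zeta w * u w) z
      + D.minusPart (fun w => deriv P.ell w * V w) z)

section GradVec

variable {u V : ℂ → ℂ}

theorem analyticOnNhd_deriv_zeta_mul (hu : AnalyticOnNhd ℂ u D.contour) :
    AnalyticOnNhd ℂ (fun w => deriv P.zeta w * u w) D.contour :=
  P.analyticOnNhd_zeta_contour.deriv.mul hu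

theorem analyticOnNhd_deriv_ell_mul (hV : AnalyticOnNhd ℂ V D.interiorDomain) :
    AnalyticOnNhd ℂ (fun w => deriv P.ell w * V w) D.contour :=
  P.analyticOnNhd_ell_contour.deriv.mul (hV.mono D.contour_subset_interiorDomain)

/-- On `D^int`, `(ℓ' V)_- = ℓ' V - (ℓ' V)_+`, and the poles come from the double poles of `ℓ'`. The
summand `G` accommodates the analytic term in the second component of `gradVec`. -/
theorem minusPart_order (hV : AnalyticOnNhd ℂ V D.interiorDomain) {G : ℂ → ℂ}
    (hG : AnalyticOnNhd ℂ G D.interiorDomain) (j : Fin m) :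
    MeromorphicAt (fun z => G z + D.minusPart (fun w => deriv P.ell w * V w) z) (P.φ j) ∧
    -2 ≤ meromorphicOrderAt (fun z => G z + D.minusPart (fun w => deriv P.ell w * V w) z)
      (P.φ j) := by
  have hφ := P.φ_mem_interiorDomain j
  have hH := (hG.sub (analyticOnNhd_plusPart (P.analyticOnNhd_deriv_ell_mul hV))) _ hφ
  set H := G - D.plusPart (fun w => deriv P.ell w * V w) with hHdef
  have heq : (fun z => G z + D.minusPart (fun w => deriv P.ell w * V w) z)
      = deriv P.ell * V + H := by
    funext z
    rw [minusPart_eq_sub]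
    simp only [hHdef, Pi.add_apply, Pi.mul_apply, Pi.sub_apply]
    ring
  have h1 := P.meromorphicAt_deriv_ell j
  have h2 := (hV _ hφ).meromorphicAt
  rw [heq]
  refine ⟨(h1.mul h2).add hH.meromorphicAt, ?_⟩
  refine le_trans (le_min ?_ ?_) (meromorphicOrderAt_add (h1.mul h2) hH.meromorphicAt)
  · rw [meromorphicOrderAt_mul h1 h2, P.meromorphicOrderAt_deriv_ell j]
    calc (-2 : WithTop ℤ) = ((-2 : ℤ) : WithTop ℤ) + 0 := by decide
      _ ≤ _ := by gcongr; exact (hV _ hφ).meromorphicOrderAt_nonneg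
  · exact le_trans (by decide) hH.meromorphicOrderAt_nonneg

theorem analyticOnNhd_minusPart_interior {f : ℂ → ℂ}
    (hf : AnalyticOnNhd ℂ f (D.interiorDomain \ range P.φ)) :
    AnalyticOnNhd ℂ (D.minusPart f) (D.interiorDomain \ range P.φ) := by
  rw [minusPart_eq_sub]
  exact hf.sub ((analyticOnNhd_plusPart (hf.mono P.contour_subset_diff)).mono sdiff_subset)

theorem isTangent_gradVec (hu : AnalyticOnNhd ℂ u D.contour)
    (hV : AnalyticOnNhd ℂ V D.interiorDomain) : P.IsTangent (P.gradVec u V) := by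
  have hz := P.analyticOnNhd_deriv_zeta_mul hu
  have hl := P.analyticOnNhd_deriv_ell_mul hV
  refine ⟨(analyticOnNhd_minusPart hz).add (analyticOnNhd_minusPart hl), ?_, ?_,
    fun j => minusPart_order hV (analyticOnNhd_plusPart hz).neg j⟩
  · simpa [gradVec] using (tendsto_minusPart hz).add (tendsto_minusPart hl)
  · exact ((analyticOnNhd_plusPart hz).mono sdiff_subset).neg.add
      (analyticOnNhd_minusPart_interior
        (P.analyticOnNhd_ell_interior.deriv.mul (hV.mono sdiff_subset)))

theorem minusPart_gradVec_snd (hu : AnalyticOnNhd ℂ u D.contour)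
    (hV : AnalyticOnNhd ℂ V D.interiorDomain) (z : ℂ) :
    D.minusPart (P.gradVec u V).2 z = D.minusPart (fun w => deriv P.ell w * V w) z := by
  have hz := P.analyticOnNhd_deriv_zeta_mul hu
  have hl := P.analyticOnNhd_deriv_ell_mul hV
  have hs : D.IsSplitting (P.gradVec u V).2
      (fun z => -D.plusPart (fun w => deriv P.zeta w * u w) z)
      (D.minusPart (fun w => deriv P.ell w * V w)) :=
    ⟨(analyticOnNhd_plusPart hz).neg, analyticOnNhd_minusPart hl, tendsto_minusPart hl,
      Eventually.of_forall fun z => rfl⟩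
  have h1 := hs.plusPart_apply (fun z => rfl) z
  have h2 := D.plusPart_add_minusPart (P.gradVec u V).2 z
  rw [h1] at h2
  exact add_left_cancel (h2.trans rfl)

/-- The quotient is `V ∂_X â - V (∂_X â)_+ - (ℓ' V)_+ (∂_X â)_- / ℓ'`. The second term is analytic
at `φ_j`; so is the third after removing its singularity, since a pole of order at most `2` is
divided by one of order exactly `2`. What remains is the residue of `V ∂_X â`. -/
theorem hasResidue_gradVec (hu : AnalyticOnNhd ℂ u D.contour)
    (hV : AnalyticOnNhd ℂ V D.interiorDomain) (hX : P.IsTangent X) (j : Fin m) :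
    HasResidue (fun z => dEll D (P.gradVec u V) z * dEll D X z / deriv P.ell z) (P.φ j)
      (D.contourInt j fun z => V z * X.2 z) := by
  have hφ := P.φ_mem_interiorDomain j
  have hl := P.analyticOnNhd_deriv_ell_mul hV
  obtain ⟨hXm, hXo⟩ := hX.2.2.2 j
  have hG := analyticOnNhd_plusPart hl _ hφ
  have hH := analyticOnNhd_plusPart hX.analyticOnNhd_snd _ hφ
  have hlm := P.meromorphicAt_deriv_ell j
  obtain ⟨g, hg, hgeq⟩ : ∃ g, AnalyticAt ℂ g (P.φ j) ∧
      (X.2 - D.plusPart X.2) / deriv P.ell =ᶠ[𝓝[≠] P.φ j] g := by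
    have hm := hXm.sub hH.meromorphicAt
    refine (hm.div hlm).meromorphicOrderAt_nonneg_iff.1 ?_
    have h2 : -2 ≤ meromorphicOrderAt (X.2 - D.plusPart X.2) (P.φ j) := by
      rw [sub_eq_add_neg]
      refine le_trans (le_min hXo ?_) (meromorphicOrderAt_add hXm hH.neg.meromorphicAt)
      exact le_trans (by decide) hH.neg.meromorphicOrderAt_nonneg
    rw [div_eq_mul_inv, meromorphicOrderAt_mul hm hlm.inv, meromorphicOrderAt_inv,
      P.meromorphicOrderAt_deriv_ell j]
    calc (0 : WithTop ℤ) = -2 + -((-2 : ℤ) : WithTop ℤ) := by decide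
      _ ≤ _ := by gcongr
  have hVX : MeromorphicAt (fun z => V z * X.2 z) (P.φ j) := (hV _ hφ).meromorphicAt.mul hXm
  have hrest : AnalyticAt ℂ (fun z => -(V z * D.plusPart X.2 z)
      - D.plusPart (fun w => deriv P.ell w * V w) z * g z) (P.φ j) :=
    (((hV _ hφ).mul hH).neg).sub (hG.mul hg)
  have h1 := (P.hasResidue_contourInt (f := fun z => V z * X.2 z)
    ((hV.mono sdiff_subset).mul hX.2.2.1) hVX).add
    (hasResidue_zero_of_order_nonneg hrest.meromorphicAt hrest.meromorphicOrderAt_nonneg)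
    hVX hrest.meromorphicAt
  rw [add_zero] at h1
  refine h1.congr ?_
  have hne : ∀ᶠ z in 𝓝[≠] P.φ j, deriv P.ell z ≠ 0 :=
    (meromorphicOrderAt_ne_top_iff_eventually_ne_zero hlm).1
      (by rw [P.meromorphicOrderAt_deriv_ell j]; exact WithTop.coe_ne_top)
  filter_upwards [hne, hgeq] with z hz hgz
  rw [(isTangent_gradVec hu hV).dEll_eq, hX.dEll_eq, minusPart_gradVec_snd hu hV, ← hgz,
    minusPart_eq_sub, minusPart_eq_sub]
  simp only [Pi.div_apply, Pi.sub_apply]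
  field_simp
  ring

theorem residueInfty_metric (hX : P.IsTangent X) (hY : P.IsTangent Y) :
    residueInfty (fun z => dEll D Y z * dEll D X z / deriv P.ell z) = 0 := by
  refine residueInfty_eq_zero ?_
  rw [hX.dEll_eq, hY.dEll_eq]
  have h1 := tendsto_mul_of_analyticOnNhd_exteriorDomain
    (analyticOnNhd_minusPart hY.analyticOnNhd_snd) (tendsto_minusPart hY.analyticOnNhd_snd)
  have h2 := (h1.mul (tendsto_minusPart hX.analyticOnNhd_snd)).div P.tendsto_deriv_ell one_ne_zero
  rw [mul_zero, zero_div] at h2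
  refine h2.congr fun z => ?_
  simp only [Pi.div_apply]
  ring

/-- On `γ` the first integrand is `u ∂_X ζ`. The residue at infinity vanishes, and the residues at
the `φ_j` add up to the contour integral of `V ∂_X â`. -/
theorem metric_gradVec (hu : AnalyticOnNhd ℂ u D.contour)
    (hV : AnalyticOnNhd ℂ V D.interiorDomain) (hX : P.IsTangent X) :
    P.metric (P.gradVec u V) X
      = D.totalInt fun z => -(X.1 z * u z) + X.2 z * (u z - V z) := by
  have hc1 : ContinuousOn (fun z => u z * (X.1 z - X.2 z)) D.contour :=
    (hu.mul (hX.analyticOnNhd_fst.sub hX.analyticOnNhd_snd)).continuousOn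
  have hc2 : ContinuousOn (fun z => V z * X.2 z) D.contour :=
    ((hV.mono D.contour_subset_interiorDomain).mul hX.analyticOnNhd_snd).continuousOn
  rw [metric, residueInfty_metric hX (isTangent_gradVec hu hV),
    Finset.sum_congr rfl fun j _ => (hasResidue_gradVec hu hV hX j).residue_eq, zero_add]
  change _ - D.totalInt (fun z => V z * X.2 z) = _
  have h1 : D.totalInt (fun z => dZeta (P.gradVec u V) z * dZeta X z / deriv P.zeta z)
      = D.totalInt fun z => u z * (X.1 z - X.2 z) := by
    refine totalInt_congr fun z hz => ?_
    have hne : deriv P.zeta z ≠ 0 := P.zeta_deriv_ne_zero z hz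
    have h2 : dZeta (P.gradVec u V) z = deriv P.zeta z * u z := by
      rw [← D.plusPart_add_minusPart (fun w => deriv P.zeta w * u w) z]
      simp only [dZeta, gradVec]
      ring
    rw [h2, dZeta]
    field_simp
  rw [h1, ← totalInt_neg, sub_eq_add_neg, ← totalInt_neg, ← totalInt_add hc1.fun_neg hc2.fun_neg]
  exact totalInt_congr fun z _ => by ring

end GradVec

end Point

end Whitham

/-! ### Adjointness of the projections; the densities and the `Ω`'s -/

namespace Whitham

open Metric Set

variable {m : ℕ}

namespace DiskConfig

variable {D : DiskConfig m} {f g : ℂ → ℂ}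

theorem IsSplitting.const_mul {p q : ℂ → ℂ} (h : D.IsSplitting f p q) (c : ℂ) :
    D.IsSplitting (fun z => c * f z) (fun z => c * p z) fun z => c * q z := by
  refine ⟨analyticOnNhd_const.mul h.1, analyticOnNhd_const.mul h.2.1, ?_, ?_⟩
  · simpa using h.2.2.1.const_mul c
  · filter_upwards [h.2.2.2] with z hz
    rw [hz, mul_add]

theorem plusPart_const_mul (hf : AnalyticOnNhd ℂ f D.contour) (c : ℂ) {z : ℂ}
    (hz : z ∈ D.contour) : D.plusPart (fun w => c * f w) z = c * D.plusPart f z :=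
  ((isSplitting_plusPart_minusPart hf).const_mul c).plusPart_eq.self_of_nhdsSet
    (D.contour_subset_interiorDomain hz)

theorem minusPart_const_mul (hf : AnalyticOnNhd ℂ f D.contour) (c : ℂ) {z : ℂ}
    (hz : z ∈ D.contour) : D.minusPart (fun w => c * f w) z = c * D.minusPart f z :=
  ((isSplitting_plusPart_minusPart hf).const_mul c).minusPart_eq.self_of_nhdsSet
    (D.contour_subset_exteriorDomain hz)

theorem analyticOnNhd_plusPart_contour (hf : AnalyticOnNhd ℂ f D.contour) :
    AnalyticOnNhd ℂ (D.plusPart f) D.contour :=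
  (analyticOnNhd_plusPart hf).mono D.contour_subset_interiorDomain

theorem analyticOnNhd_minusPart_contour (hf : AnalyticOnNhd ℂ f D.contour) :
    AnalyticOnNhd ℂ (D.minusPart f) D.contour :=
  (analyticOnNhd_minusPart hf).mono D.contour_subset_exteriorDomain

theorem deriv_eq_deriv_plusPart_add (hf : AnalyticOnNhd ℂ f D.contour) {z : ℂ}
    (hz : z ∈ D.contour) : deriv f z = deriv (D.plusPart f) z + deriv (D.minusPart f) z := by
  rw [← deriv_fun_add (analyticOnNhd_plusPart_contour hf z hz).differentiableAt
    (analyticOnNhd_minusPart_contour hf z hz).differentiableAt]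
  congr 1
  exact funext fun w => (D.plusPart_add_minusPart f w).symm

theorem isNull_plusPart_mul (hf : AnalyticOnNhd ℂ f D.contour) (hg : AnalyticOnNhd ℂ g D.contour) :
    D.IsNull fun z => D.plusPart f z * D.plusPart g z :=
  isNull_of_interiorDomain ((analyticOnNhd_plusPart hf).mul (analyticOnNhd_plusPart hg))

theorem isNull_minusPart_mul (hf : AnalyticOnNhd ℂ f D.contour)
    (hg : AnalyticOnNhd ℂ g D.contour) :
    D.IsNull fun z => D.minusPart f z * D.minusPart g z :=
  isNull_mul_of_exteriorDomain (analyticOnNhd_minusPart hf) (analyticOnNhd_minusPart hg)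
    (tendsto_minusPart hf) (tendsto_minusPart hg)

/-- Adjointness of the projections: both terms have the integral `∮ g_- f_+`. -/
theorem isNull_mul_plusPart (hf : AnalyticOnNhd ℂ f D.contour)
    (hg : AnalyticOnNhd ℂ g D.contour) :
    D.IsNull fun z => g z * D.plusPart f z - D.minusPart g z * f z := by
  refine ((isNull_plusPart_mul hf hg).sub (isNull_minusPart_mul hf hg)).congr fun z _ => ?_
  linear_combination D.minusPart g z * D.plusPart_add_minusPart f z
    - D.plusPart f z * D.plusPart_add_minusPart g z

theorem isNull_mul_minusPart (hf : AnalyticOnNhd ℂ f D.contour)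
    (hg : AnalyticOnNhd ℂ g D.contour) :
    D.IsNull fun z => g z * D.minusPart f z - D.plusPart g z * f z := by
  refine ((isNull_minusPart_mul hf hg).sub (isNull_plusPart_mul hf hg)).congr fun z _ => ?_
  linear_combination D.plusPart g z * D.plusPart_add_minusPart f z
    - D.minusPart f z * D.plusPart_add_minusPart g z

/-- Integration by parts for the projections. -/
theorem isNull_minusPart_mul_deriv_add (hf : AnalyticOnNhd ℂ f D.contour)
    (hg : AnalyticOnNhd ℂ g D.contour) :
    D.IsNull fun z => D.minusPart f z * deriv g z + D.plusPart g z * deriv f z := by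
  have h1 := isNull_deriv_mul_add (analyticOnNhd_minusPart_contour hf) hg
  have h2 : D.IsNull fun z => deriv (D.minusPart f) z * D.minusPart g z :=
    isNull_mul_of_exteriorDomain (analyticOnNhd_minusPart hf).deriv (analyticOnNhd_minusPart hg)
      (tendsto_deriv_of_analyticOnNhd_exteriorDomain (analyticOnNhd_minusPart hf)
        (tendsto_minusPart hf)) (tendsto_minusPart hg)
  have h3 : D.IsNull fun z => deriv (D.plusPart f) z * D.plusPart g z :=
    isNull_of_interiorDomain ((analyticOnNhd_plusPart hf).deriv.mul (analyticOnNhd_plusPart hg))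
  refine ((h1.sub h2).add h3).congr fun z hz => ?_
  linear_combination D.plusPart g z * deriv_eq_deriv_plusPart_add hf hz
    + deriv (D.minusPart f) z * D.plusPart_add_minusPart g z

variable (D) in
/-- Functions that are locally constant near the contour. -/
def LocallyConstant (χ : ℂ → ℂ) : Prop := ∀ z ∈ D.contour, ∃ c, χ =ᶠ[𝓝 z] fun _ => c

theorem locallyConstant_charFun (k : Fin m) : D.LocallyConstant (D.charFun k) := by
  intro z hz
  obtain ⟨j, hj⟩ := mem_iUnion.1 hz
  exact ⟨_, D.charFun_eventuallyEq (sphere_subset_closedBall hj) k⟩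

theorem locallyConstant_sum_charFun : D.LocallyConstant fun z => ∑ k, D.charFun k z :=
  fun _ hz => ⟨1, D.sum_charFun_eventuallyEq (D.contour_subset_interiorDomain hz)⟩

theorem LocallyConstant.mul {χ ψ : ℂ → ℂ} (hχ : D.LocallyConstant χ)
    (hψ : D.LocallyConstant ψ) : D.LocallyConstant fun z => χ z * ψ z := by
  intro z hz
  obtain ⟨c, hc⟩ := hχ z hz
  obtain ⟨d, hd⟩ := hψ z hz
  exact ⟨c * d, hc.mul hd⟩

theorem LocallyConstant.analyticOnNhd {χ : ℂ → ℂ} (hχ : D.LocallyConstant χ) :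
    AnalyticOnNhd ℂ χ D.contour := fun z hz =>
  let ⟨_, hc⟩ := hχ z hz
  analyticAt_const.congr hc.symm

theorem LocallyConstant.deriv_mul {χ b : ℂ → ℂ} (hχ : D.LocallyConstant χ) {z : ℂ}
    (hz : z ∈ D.contour) : deriv (fun w => b w * χ w) z = deriv b z * χ z := by
  obtain ⟨c, hc⟩ := hχ z hz
  have : (fun w => b w * χ w) =ᶠ[𝓝 z] fun w => b w * c := by
    filter_upwards [hc] with w hw
    rw [hw]
  rw [this.deriv_eq, deriv_mul_const_field, hc.self_of_nhds]

theorem isNull_pow_mul_deriv_mul {χ b : ℂ → ℂ} (hb : AnalyticOnNhd ℂ b D.contour)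
    (hχ : D.LocallyConstant χ) (n : ℕ) : D.IsNull fun z => b z ^ n * deriv b z * χ z := by
  have hn : ((n : ℂ) + 1) ≠ 0 := by exact_mod_cast n.succ_ne_zero
  have hbn : AnalyticOnNhd ℂ (fun z => b z ^ (n + 1) / (n + 1)) D.contour :=
    (hb.pow (n + 1)).div analyticOnNhd_const fun _ _ => hn
  refine (isNull_deriv (hbn.mul hχ.analyticOnNhd)).congr fun z hz => ?_
  change _ = deriv (fun w => b w ^ (n + 1) / (n + 1) * χ w) z
  rw [hχ.deriv_mul hz, deriv_div_const, deriv_fun_pow (hb z hz).differentiableAt]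
  push_cast
  field_simp

end DiskConfig

open DiskConfig

variable {D : DiskConfig m}

section Density

variable (P : Point D)

/-- The function whose powers give the densities. -/
def Sector.base : Sector m → ℂ → ℂ
  | .h _ => P.aHat
  | .e => P.a

variable (D) in
/-- The locally constant factor of the densities. -/
noncomputable def Sector.cutoff : Sector m → ℂ → ℂ
  | .h k => D.charFun k
  | .e => fun z => ∑ k, D.charFun k z

theorem density_eq (α : Sector m) (p : ℕ) :
    density P α p = fun z => (p.factorial : ℂ)⁻¹ * α.base P z ^ p * α.cutoff D z := by
  cases α <;> rfl

theorem locallyConstant_cutoff (α : Sector m) : D.LocallyConstant (α.cutoff D) := by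
  cases α
  · exact locallyConstant_charFun _
  · exact locallyConstant_sum_charFun

theorem analyticOnNhd_base (α : Sector m) : AnalyticOnNhd ℂ (α.base P) D.contour := by
  cases α
  · exact P.aHat_analytic_contour
  · exact P.a_analytic_contour

theorem analyticOnNhd_density (α : Sector m) (p : ℕ) :
    AnalyticOnNhd ℂ (density P α p) D.contour := by
  rw [density_eq]
  exact (analyticOnNhd_const.mul ((analyticOnNhd_base P α).pow p)).mul
    (locallyConstant_cutoff α).analyticOnNhd

theorem deriv_density_zero (α : Sector m) {z : ℂ} (hz : z ∈ D.contour) :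
    deriv (density P α 0) z = 0 := by
  rw [density_eq]
  simp only [pow_zero]
  rw [(locallyConstant_cutoff α).deriv_mul hz]
  simp

theorem deriv_density_succ (α : Sector m) (p : ℕ) {z : ℂ} (hz : z ∈ D.contour) :
    deriv (density P α (p + 1)) z = density P α p z * deriv (α.base P) z := by
  rw [density_eq, density_eq, (locallyConstant_cutoff α).deriv_mul hz, deriv_const_mul_field,
    deriv_fun_pow (analyticOnNhd_base P α z hz).differentiableAt]
  push_cast
  simp only [mul_assoc]
  rw [factorial_succ_inv_mul]
  ring

/-- Such products are derivatives of powers of the common base times a locally constant function.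
This covers two `h`-indices or two `e`'s; the mixed case uses different bases and has to do without
it. -/
theorem isNull_density_mul {α β : Sector m} (h : α.base P = β.base P) (p q : ℕ) :
    D.IsNull fun z => density P α p z * density P β q z * deriv (α.base P) z := by
  have hχ := (locallyConstant_cutoff (D := D) α).mul (locallyConstant_cutoff β)
  have hc : D.LocallyConstant fun _ => ((p.factorial : ℂ)⁻¹ * (q.factorial : ℂ)⁻¹) :=
    fun _ _ => ⟨_, EventuallyEq.rfl⟩
  refine (isNull_pow_mul_deriv_mul (analyticOnNhd_base P α) (hc.mul hχ) (p + q)).congr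
    fun z _ => ?_
  rw [density_eq, density_eq, h]
  ring

theorem isNull_density_mul_deriv {β : Sector m} (q : ℕ) :
    D.IsNull fun z => density P β q z * deriv (β.base P) z := by
  refine (isNull_pow_mul_deriv_mul (analyticOnNhd_base P β)
    (LocallyConstant.mul (fun _ _ => ⟨(q.factorial : ℂ)⁻¹, EventuallyEq.rfl⟩)
      (locallyConstant_cutoff β)) q).congr fun z _ => ?_
  rw [density_eq]
  ring

theorem theta_eq (α : Sector m) (p : ℕ) : theta α p P = D.totalInt (density P α (p + 1)) := by
  cases α with
  | h k =>
    simp only [theta, P.thetaH_eq, density]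
    rw [totalInt_mul_charFun, contourInt, contourInt, circleIntegral.integral_const_mul]
    ring
  | e =>
    rw [P.theta_e_eq]
    simp only [density, totalInt, contourInt]
    refine Finset.sum_congr rfl fun k _ => ?_
    have h : (∮ z in C(D.center k, D.radius k),
        ((p + 1).factorial : ℂ)⁻¹ * P.a z ^ (p + 1) * ∑ k, D.charFun k z)
        = ∮ z in C(D.center k, D.radius k), ((p + 1).factorial : ℂ)⁻¹ * P.a z ^ (p + 1) := by
      refine circleIntegral.integral_congr (D.radius_pos k).le fun z hz => ?_
      have := (D.sum_charFun_eventuallyEq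
        (D.closedBall_subset_interiorDomain k (sphere_subset_closedBall hz))).self_of_nhds
      simp only at this
      simp only [this, mul_one]
    rw [h, circleIntegral.integral_const_mul]
    ring

theorem Q_eq (α : Sector m) (p : ℕ) :
    Q P α p = fun z => ((1 + p).factorial : ℂ) * density P α (p + 1) z := by
  have h : ((1 + p).factorial : ℂ) ≠ 0 := by exact_mod_cast Nat.factorial_ne_zero _
  have h' : 1 + p = p + 1 := add_comm _ _
  rw [h'] at h ⊢
  cases α <;> funext z <;> simp only [Q, density] <;> field_simp

theorem totalInt_minusPart_Q (α β : Sector m) (p q : ℕ) :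
    (((1 + p).factorial : ℂ) * ((1 + q).factorial : ℂ))⁻¹ *
        D.totalInt (fun z => D.minusPart (Q P α p) z * deriv (Q P β q) z)
      = D.totalInt fun z =>
        D.minusPart (density P α (p + 1)) z * deriv (density P β (q + 1)) z := by
  have h : ∀ p : ℕ, ((1 + p).factorial : ℂ) ≠ 0 := fun p => by
    exact_mod_cast Nat.factorial_ne_zero _
  rw [← totalInt_const_mul]
  refine totalInt_congr fun z hz => ?_
  simp only [Q_eq, minusPart_const_mul (analyticOnNhd_density P α (p + 1)) _ hz,
    deriv_const_mul_field]
  have h1 := h p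
  have h2 := h q
  field_simp

theorem totalInt_plusPart_Q (α β : Sector m) (p q : ℕ) :
    (((1 + p).factorial : ℂ) * ((1 + q).factorial : ℂ))⁻¹ *
        D.totalInt (fun z => D.plusPart (Q P α p) z * deriv (Q P β q) z)
      = D.totalInt fun z =>
        D.plusPart (density P α (p + 1)) z * deriv (density P β (q + 1)) z := by
  have h : ∀ p : ℕ, ((1 + p).factorial : ℂ) ≠ 0 := fun p => by
    exact_mod_cast Nat.factorial_ne_zero _
  rw [← totalInt_const_mul]
  refine totalInt_congr fun z hz => ?_
  simp only [Q_eq, plusPart_const_mul (analyticOnNhd_density P α (p + 1)) _ hz,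
    deriv_const_mul_field]
  have h1 := h p
  have h2 := h q
  field_simp

variable {P}

theorem continuousOn_minusPart_mul_deriv {f g : ℂ → ℂ} (hf : AnalyticOnNhd ℂ f D.contour)
    (hg : AnalyticOnNhd ℂ g D.contour) :
    ContinuousOn (fun z => D.minusPart f z * deriv g z) D.contour :=
  ((analyticOnNhd_minusPart_contour hf).mul hg.deriv).continuousOn

theorem continuousOn_plusPart_mul_deriv {f g : ℂ → ℂ} (hf : AnalyticOnNhd ℂ f D.contour)
    (hg : AnalyticOnNhd ℂ g D.contour) :
    ContinuousOn (fun z => D.plusPart f z * deriv g z) D.contour :=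
  ((analyticOnNhd_plusPart_contour hf).mul hg.deriv).continuousOn

theorem Omega_e (p : ℕ) (β : Sector m) (q : ℕ) :
    Omega .e p β q P = -D.totalInt fun z =>
      D.plusPart (density P .e (p + 1)) z * deriv (density P β (q + 1)) z := by
  rw [← totalInt_plusPart_Q]
  cases β <;> rfl

/-- For `β = e` the component is given with its indices exchanged, and integration by parts for the
projections restores the uniform formula. -/
theorem Omega_h (k : Fin m) (p : ℕ) (β : Sector m) (q : ℕ) :
    Omega (.h k) p β q P = D.totalInt fun z =>
      D.minusPart (density P (.h k) (p + 1)) z * deriv (density P β (q + 1)) z := by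
  cases β with
  | h l => rw [← totalInt_minusPart_Q]; rfl
  | e =>
    have h1 : Omega (.h k) p .e q P = Omega .e q (.h k) p P := rfl
    have hF := analyticOnNhd_density P (.h k) (p + 1)
    have hG := analyticOnNhd_density P .e (q + 1)
    rw [h1, Omega_e, ← totalInt_neg]
    refine ((isNull_minusPart_mul_deriv_add hF hG).neg).totalInt_eq
      (continuousOn_minusPart_mul_deriv hF hG) fun z _ => by ring

/-- With `F = f_{α,p+1}` and `G = f_{β,q+1}`, integration by parts turns `F_- dG` into `-G_+ dF =
G_- dF - G dF`, and `G dF` is exact when the bases agree. The case of two `e`'s is the same with the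
projections exchanged; the mixed case holds by definition. -/
theorem Omega_symm (α : Sector m) (p : ℕ) (β : Sector m) (q : ℕ) :
    Omega α p β q P = Omega β q α p P := by
  have hF := analyticOnNhd_density P α (p + 1)
  have hG := analyticOnNhd_density P β (q + 1)
  have hA := isNull_minusPart_mul_deriv_add hF hG
  match α, β with
  | .h k, .h l =>
    have hN := isNull_density_mul P (α := .h k) (β := .h l) rfl p (q + 1)
    rw [Omega_h, Omega_h]
    refine (hA.sub hN).totalInt_eq (continuousOn_minusPart_mul_deriv hG hF) fun z hz => ?_
    have h1 := D.plusPart_add_minusPart (density P (.h l) (q + 1)) z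
    have h2 := deriv_density_succ P (.h k) p hz
    linear_combination (-density P (.h l) (q + 1) z) * h2
      - deriv (density P (.h k) (p + 1)) z * h1
  | .h k, .e => rfl
  | .e, .h l => rfl
  | .e, .e =>
    have hN := isNull_density_mul P (α := .e) (β := .e) rfl (p + 1) q
    rw [Omega_e, Omega_e]
    congr 1
    refine (hN.sub hA).totalInt_eq (continuousOn_plusPart_mul_deriv hG hF) fun z hz => ?_
    have h1 := D.plusPart_add_minusPart (density P .e (p + 1)) z
    have h2 := deriv_density_succ P .e q hz
    linear_combination density P .e (p + 1) z * h2
      + deriv (density P .e (q + 1)) z * h1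

theorem plusPart_density_e_one {z : ℂ} (hz : z ∈ D.contour) :
    D.plusPart (density P .e 1) z = z := by
  have h : D.IsSplitting (density P .e 1) (fun z => z) fun z => P.a z - z := by
    refine ⟨P.isSplitting_a.1, P.isSplitting_a.2.1, P.isSplitting_a.2.2.1, ?_⟩
    refine eventually_nhdsSet_iff_forall.2 fun z hz => ?_
    filter_upwards [D.sum_charFun_eventuallyEq (D.contour_subset_interiorDomain hz)] with w hw
    simp [density, hw]
  exact h.plusPart_eq.self_of_nhdsSet (D.contour_subset_interiorDomain hz)

/-- Here the plus part is `a_+ = z`, so one integration by parts removes it. -/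
theorem Omega_e_zero (β : Sector m) (q : ℕ) :
    Omega .e 0 β q P = D.totalInt (density P β (q + 1)) := by
  have hG := analyticOnNhd_density P β (q + 1)
  rw [Omega_e, ← totalInt_neg]
  have hid : AnalyticOnNhd ℂ (fun z : ℂ => z) D.contour := fun _ _ => analyticAt_id
  refine (isNull_deriv_mul_add hid hG).neg.totalInt_eq hG.continuousOn fun z hz => ?_
  rw [plusPart_density_e_one hz, deriv_id'']
  ring

end Density

end Whitham

namespace Whitham

open Metric Set DiskConfig

variable {m : ℕ} {D : DiskConfig m} {P : Point D}

/-! ### Gradients of the densities -/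

section Gradient

variable (P) in
/-- The gradients of the densities. -/
noncomputable def gradTheta (α : Sector m) (p : ℕ) : (ℂ → ℂ) × (ℂ → ℂ) :=
  match α with
  | .h k => P.gradVec (D.minusPart (density P (.h k) p)) fun z => -D.plusPart (density P (.h k) p) z
  | .e => P.gradVec (fun z => -D.plusPart (density P .e p) z)
      fun z => -D.plusPart (density P .e p) z

theorem isTangent_gradTheta (α : Sector m) (p : ℕ) : P.IsTangent (gradTheta P α p) := by
  have hf := analyticOnNhd_density P α p
  cases α with
  | h k =>
    exact Point.isTangent_gradVec (analyticOnNhd_minusPart_contour hf)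
      (analyticOnNhd_plusPart hf).neg
  | e =>
    exact Point.isTangent_gradVec (analyticOnNhd_plusPart_contour hf).neg
      (analyticOnNhd_plusPart hf).neg

theorem continuousOn_density_mul_component {X : (ℂ → ℂ) × (ℂ → ℂ)} (hX : P.IsTangent X)
    (α : Sector m) (p : ℕ) :
    ContinuousOn (fun z => density P α p z * component α X z) D.contour := by
  cases α
  · exact ((analyticOnNhd_density P _ p).mul hX.analyticOnNhd_snd).continuousOn
  · exact ((analyticOnNhd_density P _ p).mul hX.analyticOnNhd_fst).continuousOn

/-- For `h_{k,0}`, `u - V` is the whole density and `u ∂_X a` is null. For `e`, `u - V = 0` and `-u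
∂_X a` is the density times `∂_X a` up to a null function. Both times the null function is a product
of two functions analytic on `D^ext` that vanish at infinity. -/
theorem metric_gradTheta {X : (ℂ → ℂ) × (ℂ → ℂ)} (hX : P.IsTangent X) (α : Sector m) (p : ℕ) :
    P.metric (gradTheta P α p) X = D.totalInt fun z => density P α p z * component α X z := by
  have hf := analyticOnNhd_density P α p
  have hN : D.IsNull fun z => X.1 z * D.minusPart (density P α p) z :=
    isNull_mul_of_exteriorDomain hX.1 (analyticOnNhd_minusPart hf) hX.2.1 (tendsto_minusPart hf)
  have hcont := continuousOn_density_mul_component hX α p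
  cases α with
  | h k =>
    refine (Point.metric_gradVec (analyticOnNhd_minusPart_contour hf)
      (analyticOnNhd_plusPart hf).neg hX).trans (hN.neg.totalInt_eq hcont fun z _ => ?_)
    simp only [component, Pi.neg_apply]
    linear_combination X.2 z * D.plusPart_add_minusPart (density P (.h k) p) z
  | e =>
    refine (Point.metric_gradVec (analyticOnNhd_plusPart_contour hf).neg
      (analyticOnNhd_plusPart hf).neg hX).trans (hN.neg.totalInt_eq hcont fun z _ => ?_)
    simp only [component, Pi.neg_apply]
    linear_combination X.1 z * D.plusPart_add_minusPart (density P .e p) z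

theorem isGradient_gradTheta (α : Sector m) (p : ℕ) :
    IsGradient (theta α p) P (gradTheta P α p) :=
  ⟨isTangent_gradTheta α p, fun _ hX => metric_gradTheta hX α p ▸ P.hasDirDeriv_theta hX α p⟩

theorem IsGradient.metric_eq {α : Sector m} {p : ℕ} {X Y : (ℂ → ℂ) × (ℂ → ℂ)}
    (hY : IsGradient (theta α p) P Y) (hX : P.IsTangent X) :
    P.metric Y X = D.totalInt fun z => density P α p z * component α X z :=
  (hY.2 X hX).unique (P.hasDirDeriv_theta hX α p)

/-- Evaluating the product as a derivative twice, once for each gradient, replaces an arbitrary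
gradient by the explicit one; nondegeneracy of the metric is not needed. -/
theorem metric_isGradient {α β : Sector m} {p q : ℕ} {Y Z : (ℂ → ℂ) × (ℂ → ℂ)}
    (hY : IsGradient (theta α p) P Y) (hZ : IsGradient (theta β q) P Z) :
    P.metric Y Z
      = D.totalInt fun z => density P β q z * component β (gradTheta P α p) z := by
  rw [hY.metric_eq hZ.1, ← metric_gradTheta hZ.1, Point.metric_comm,
    hZ.metric_eq (isTangent_gradTheta α p)]

end Gradient

/-! ### The recursion for the `Ω`'s -/

section Recursion

variable (P) in
/-- `Ω_{α,p;β,q-1}`, as an integral that vanishes for `q = 0`. -/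
noncomputable def shiftedOmega (α : Sector m) (p : ℕ) (β : Sector m) (q : ℕ) : ℂ :=
  match α with
  | .h k => D.totalInt fun z =>
      D.minusPart (density P (.h k) (p + 1)) z * deriv (density P β q) z
  | .e => -D.totalInt fun z => D.plusPart (density P .e (p + 1)) z * deriv (density P β q) z

theorem shiftedOmega_eq (α : Sector m) (p : ℕ) (β : Sector m) (q : ℕ) :
    (if q = 0 then 0 else Omega α p β (q - 1) P) = shiftedOmega P α p β q := by
  cases q with
  | zero =>
    have h : ∀ f : ℂ → ℂ, D.totalInt (fun z => f z * deriv (density P β 0) z) = 0 := by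
      intro f
      rw [totalInt_congr (g := fun _ => 0 * 0)]
      · rw [totalInt_const_mul, zero_mul]
      · intro z hz
        simp [deriv_density_zero P β hz]
    cases α <;> simp [shiftedOmega, h]
  | succ q =>
    cases α with
    | h k => simp [shiftedOmega, Omega_h]
    | e => simp [shiftedOmega, Omega_e]

theorem isNull_plusPart_mul_mul_deriv {f g : ℂ → ℂ} (hf : AnalyticOnNhd ℂ f D.contour)
    (hg : AnalyticOnNhd ℂ g D.contour) :
    D.IsNull fun z => D.plusPart f z * D.plusPart g z *
      deriv (fun z => D.plusPart P.a z - D.plusPart P.aHat z) z :=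
  isNull_of_interiorDomain (((analyticOnNhd_plusPart hf).mul (analyticOnNhd_plusPart hg)).mul
    P.analyticOnNhd_plusPart_sub.deriv)

/-- Since `a'` tends to `1`, the product is of order `z⁻²` at infinity. -/
theorem isNull_minusPart_mul_mul_deriv {f g : ℂ → ℂ} (hf : AnalyticOnNhd ℂ f D.contour)
    (hg : AnalyticOnNhd ℂ g D.contour) :
    D.IsNull fun z => D.minusPart f z * D.minusPart g z * deriv P.a z :=
  isNull_mul_mul_of_exteriorDomain (analyticOnNhd_minusPart hf) (analyticOnNhd_minusPart hg)
    P.a_analytic.deriv (tendsto_minusPart hf) (tendsto_minusPart hg) P.tendsto_deriv_a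

-- Let `f`, `g` be the densities of index `p`, `q` and `F`, `G` those of index `p + 1`, `q + 1`.
-- Adjointness gives `-∮ g_- f_- ζ' - ∮ g_+ f_+ ℓ'`. Dropping `a'` from `ζ'` and the analytic part
-- from `ℓ'` leaves `∮ (g_- f_- - g_+ f_+) â'`. Modulo the null function `f g â'` this is `-∮ (f_+ g
-- + g_+ f) â' = -∮ (f_+ G' + g_+ F')`, and integration by parts yields the two `Ω`'s.
variable (P) in
theorem shiftedOmega_add_h_h (k l : Fin m) (p q : ℕ) :
    D.totalInt (fun z => density P (.h l) q z * component (.h l) (gradTheta P (.h k) p) z)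
      = shiftedOmega P (.h l) q (.h k) p + shiftedOmega P (.h k) p (.h l) q := by
  have hf := analyticOnNhd_density P (.h k) p
  have hg := analyticOnNhd_density P (.h l) q
  have hF := analyticOnNhd_density P (.h k) (p + 1)
  have hG := analyticOnNhd_density P (.h l) (q + 1)
  have hu := P.analyticOnNhd_deriv_zeta_mul (analyticOnNhd_minusPart_contour hf)
  have hV := P.analyticOnNhd_deriv_ell_mul (analyticOnNhd_plusPart hf).neg
  have n1 := isNull_mul_plusPart hu hg
  have n2 := isNull_mul_minusPart hV hg
  have n3 := isNull_minusPart_mul_deriv_add hF hg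
  have n4 := isNull_minusPart_mul_deriv_add hG hf
  have n5 := isNull_minusPart_mul_mul_deriv (P := P) hg hf
  have n6 := isNull_plusPart_mul_mul_deriv (P := P) hg hf
  have n7 := isNull_density_mul P (α := .h k) (β := .h l) rfl p q
  have hc1 := continuousOn_minusPart_mul_deriv hG hf
  have hc2 := continuousOn_minusPart_mul_deriv hF hg
  simp only [shiftedOmega]
  rw [← totalInt_add hc1 hc2]
  -- `n1`, `n2` express adjointness, `n3`, `n4` integration by parts, `n5`, `n6` the reduction of
  -- `ζ'` and `ℓ'`, and `n7` the exact term.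
  refine ((((((n2.sub n1).sub n3).sub n4).sub n5).sub n6).add n7).totalInt_eq (hc1.add hc2)
    fun z hz => ?_
  have e1 := P.deriv_zeta_eq hz
  have e2 := P.deriv_ell_eq (P.contour_subset_diff hz)
  have e3 := deriv_density_succ P (.h k) p hz
  have e4 := deriv_density_succ P (.h l) q hz
  have e5 := D.plusPart_add_minusPart (density P (.h k) p) z
  have e6 := D.plusPart_add_minusPart (density P (.h l) q) z
  simp only [component, gradTheta, Point.gradVec, Sector.base, Pi.neg_apply, e1, e2, e3, e4]
  rw [← e5, ← e6]
  ring

-- In the same notation adjointness gives `∮ g_- f_+ ζ' - ∮ g_+ f_+ ℓ'`. Since `g_- f_- a'` is null,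
-- this is `∮ g_- f a' - ∮ f_+ g â' = ∮ g_- F' - ∮ f_+ G'`, to be integrated by parts.
variable (P) in
theorem shiftedOmega_add_e_h (l : Fin m) (p q : ℕ) :
    D.totalInt (fun z => density P (.h l) q z * component (.h l) (gradTheta P .e p) z)
      = shiftedOmega P (.h l) q .e p + shiftedOmega P .e p (.h l) q := by
  have hf := analyticOnNhd_density P .e p
  have hg := analyticOnNhd_density P (.h l) q
  have hF := analyticOnNhd_density P .e (p + 1)
  have hG := analyticOnNhd_density P (.h l) (q + 1)
  have hu := P.analyticOnNhd_deriv_zeta_mul (analyticOnNhd_plusPart_contour hf).neg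
  have hV := P.analyticOnNhd_deriv_ell_mul (analyticOnNhd_plusPart hf).neg
  have n1 := isNull_mul_plusPart hu hg
  have n2 := isNull_mul_minusPart hV hg
  have n3 := isNull_minusPart_mul_deriv_add hF hg
  have n4 := isNull_minusPart_mul_deriv_add hG hf
  have n5 := isNull_minusPart_mul_mul_deriv (P := P) hg hf
  have n6 := isNull_plusPart_mul_mul_deriv (P := P) hg hf
  have n7 := isNull_deriv_mul_add hF hg
  have hc1 := continuousOn_minusPart_mul_deriv hG hf
  have hc2 := continuousOn_plusPart_mul_deriv hF hg
  simp only [shiftedOmega]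
  rw [← totalInt_neg, ← totalInt_add hc1 hc2.fun_neg]
  refine ((((((n2.sub n1).sub n3).sub n4).sub n5).sub n6).add n7).totalInt_eq
    (hc1.add hc2.fun_neg) fun z hz => ?_
  have e1 := P.deriv_zeta_eq hz
  have e2 := P.deriv_ell_eq (P.contour_subset_diff hz)
  have e3 := deriv_density_succ P .e p hz
  have e4 := deriv_density_succ P (.h l) q hz
  have e5 := D.plusPart_add_minusPart (density P .e p) z
  have e6 := D.plusPart_add_minusPart (density P (.h l) q) z
  have e7 := D.plusPart_add_minusPart (density P .e (p + 1)) z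
  simp only [component, gradTheta, Point.gradVec, Sector.base, Pi.neg_apply, e1, e2, e3, e4]
  rw [← e5, ← e6, ← e7]
  ring

-- Adjointness gives `-∮ g_+ f_+ (ζ' + ℓ')`, where `ζ' + ℓ'` is `a'` up to a function analytic on
-- `D^int`. Modulo `g_- f_- a'` and `f g a'`, the result `-∮ g_+ f_+ a'` equals `∮ (f_- g + g_- f)
-- a' = ∮ (f_- G' + g_- F')`.
variable (P) in
theorem shiftedOmega_add_e_e (p q : ℕ) :
    D.totalInt (fun z => density P .e q z * component (m := m) .e (gradTheta P .e p) z)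
      = shiftedOmega P .e q .e p + shiftedOmega P .e p .e q := by
  have hf := analyticOnNhd_density P .e p
  have hg := analyticOnNhd_density P .e q
  have hF := analyticOnNhd_density P .e (p + 1)
  have hG := analyticOnNhd_density P .e (q + 1)
  have hu := P.analyticOnNhd_deriv_zeta_mul (analyticOnNhd_plusPart_contour hf).neg
  have hV := P.analyticOnNhd_deriv_ell_mul (analyticOnNhd_plusPart hf).neg
  have n1 := isNull_mul_minusPart hu hg
  have n2 := isNull_mul_minusPart hV hg
  have n3 := isNull_minusPart_mul_deriv_add hF hg
  have n4 := isNull_minusPart_mul_deriv_add hG hf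
  have n5 := isNull_minusPart_mul_mul_deriv (P := P) hg hf
  have n6 := isNull_plusPart_mul_mul_deriv (P := P) hg hf
  have n7 := isNull_deriv_mul_add hF hg
  have n8 := isNull_deriv_mul_add hG hf
  have n9 := isNull_density_mul P (α := .e) (β := .e) rfl p q
  have hc1 := continuousOn_plusPart_mul_deriv hG hf
  have hc2 := continuousOn_plusPart_mul_deriv hF hg
  simp only [shiftedOmega]
  rw [← totalInt_neg, ← totalInt_neg, ← totalInt_add hc1.fun_neg hc2.fun_neg]
  refine ((((((((n2.add n1).sub n3).sub n4).sub n5).sub n6).add n7).add n8).sub n9).totalInt_eq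
    (hc1.fun_neg.add hc2.fun_neg) fun z hz => ?_
  have e1 := P.deriv_zeta_eq hz
  have e2 := P.deriv_ell_eq (P.contour_subset_diff hz)
  have e3 := deriv_density_succ P .e p hz
  have e4 := deriv_density_succ P .e q hz
  have e5 := D.plusPart_add_minusPart (density P .e p) z
  have e6 := D.plusPart_add_minusPart (density P .e q) z
  have e7 := D.plusPart_add_minusPart (density P .e (p + 1)) z
  have e8 := D.plusPart_add_minusPart (density P .e (q + 1)) z
  simp only [component, gradTheta, Point.gradVec, Sector.base, Pi.neg_apply, e1, e2, e3, e4]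
  rw [← e5, ← e6, ← e7, ← e8]
  ring

theorem metric_isGradient_eq {α β : Sector m} {p q : ℕ} {Y Z : (ℂ → ℂ) × (ℂ → ℂ)}
    (hY : IsGradient (theta α p) P Y) (hZ : IsGradient (theta β q) P Z) :
    P.metric Y Z = shiftedOmega P β q α p + shiftedOmega P α p β q := by
  match α, β with
  | .h k, .h l => rw [metric_isGradient hY hZ, shiftedOmega_add_h_h]
  | .e, .h l => rw [metric_isGradient hY hZ, shiftedOmega_add_e_h]
  | .e, .e => rw [metric_isGradient hY hZ, shiftedOmega_add_e_e]
  | .h k, .e => rw [Point.metric_comm, metric_isGradient hZ hY, shiftedOmega_add_e_h, add_comm]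

end Recursion

/-! ### Derivatives along the flat fields -/

section FlatFields

variable {X Y : (ℂ → ℂ) × (ℂ → ℂ)}

theorem Point.IsTangent.add (hX : P.IsTangent X) (hY : P.IsTangent Y) : P.IsTangent (X + Y) := by
  refine ⟨hX.1.add hY.1, by simpa using! hX.2.1.add hY.2.1, hX.2.2.1.add hY.2.2.1, fun j => ?_⟩
  obtain ⟨h1, h2⟩ := hX.2.2.2 j
  obtain ⟨h3, h4⟩ := hY.2.2.2 j
  exact ⟨h1.add h3, le_trans (le_min h2 h4) (meromorphicOrderAt_add h1 h3)⟩

theorem Point.isTangent_zero : P.IsTangent 0 :=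
  ⟨analyticOnNhd_const, tendsto_const_nhds, analyticOnNhd_const, fun j =>
    ⟨MeromorphicAt.const 0 _, le_trans (by decide)
      (analyticAt_const (v := (0 : ℂ)) (x := P.φ j)).meromorphicOrderAt_nonneg⟩⟩

theorem Point.isTangent_flatT (k : Fin m) : P.IsTangent (P.flatT k) := by
  have h := P.analyticOnNhd_deriv_zeta_mul (locallyConstant_charFun (D := D) k).analyticOnNhd
  refine ⟨(analyticOnNhd_minusPart h).neg, by simpa using! (tendsto_minusPart h).neg,
    (analyticOnNhd_plusPart h).mono sdiff_subset, fun j => ?_⟩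
  have hj := analyticOnNhd_plusPart h _ (P.φ_mem_interiorDomain j)
  exact ⟨hj.meromorphicAt, le_trans (by decide) hj.meromorphicOrderAt_nonneg⟩

theorem Point.isTangent_flatH (k : Fin m) : P.IsTangent (P.flatH k) := by
  have hχ := D.analyticOnNhd_charFun k
  have h := P.analyticOnNhd_deriv_ell_mul hχ
  refine ⟨(analyticOnNhd_minusPart h).neg, by simpa using! (tendsto_minusPart h).neg,
    (analyticOnNhd_minusPart_interior
      (P.analyticOnNhd_ell_interior.deriv.mul (hχ.mono sdiff_subset))).neg, fun j => ?_⟩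
  have h1 := Point.minusPart_order (P := P) hχ (G := fun _ => 0) analyticOnNhd_const j
  simp only [zero_add] at h1
  exact ⟨h1.1.neg, h1.2.trans_eq meromorphicOrderAt_neg⟩

theorem isTangent_flatField (α : Sector m) : P.IsTangent (flatField P α) := by
  cases α with
  | h k => exact Point.isTangent_flatH k
  | e =>
    exact Finset.sum_induction _ P.IsTangent (fun _ _ h1 h2 => h1.add h2) Point.isTangent_zero
      fun k _ => (Point.isTangent_flatT k).add (Point.isTangent_flatH k)

theorem isSplitting_sum_charFun {f : ℂ → ℂ} (hf : AnalyticOnNhd ℂ f D.contour) :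
    D.IsSplitting f (fun z => ∑ k, D.plusPart (fun w => f w * D.charFun k w) z)
      fun z => ∑ k, D.minusPart (fun w => f w * D.charFun k w) z := by
  have h : ∀ k, AnalyticOnNhd ℂ (fun w => f w * D.charFun k w) D.contour := fun k =>
    hf.mul (locallyConstant_charFun k).analyticOnNhd
  refine ⟨Finset.analyticOnNhd_fun_sum _ fun k _ => analyticOnNhd_plusPart (h k),
    Finset.analyticOnNhd_fun_sum _ fun k _ => analyticOnNhd_minusPart (h k), ?_, ?_⟩
  · simpa using tendsto_finsetSum Finset.univ fun k _ => tendsto_minusPart (h k)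
  · refine eventually_nhdsSet_iff_forall.2 fun z hz => ?_
    filter_upwards [D.sum_charFun_eventuallyEq (D.contour_subset_interiorDomain hz)] with w hw
    simp only [← Finset.sum_add_distrib, plusPart_add_minusPart, ← Finset.mul_sum, hw, mul_one]

theorem isSplitting_zeta : D.IsSplitting P.zeta (fun z => z - D.plusPart P.aHat z)
    fun z => P.a z - z - D.minusPart P.aHat z := by
  have h := P.aHat_analytic_contour
  refine ⟨P.isSplitting_a.1.sub (analyticOnNhd_plusPart h),
    P.isSplitting_a.2.1.sub (analyticOnNhd_minusPart h), ?_, Eventually.of_forall fun z => ?_⟩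
  · simpa using P.isSplitting_a.2.2.1.sub (tendsto_minusPart h)
  · rw [Point.zeta, ← D.plusPart_add_minusPart P.aHat z]
    ring

theorem isSplitting_ell : D.IsSplitting P.ell (fun z => z) (D.minusPart P.aHat) := by
  have h := P.aHat_analytic_contour
  refine ⟨P.isSplitting_a.1, analyticOnNhd_minusPart h, tendsto_minusPart h,
    Eventually.of_forall fun z => ?_⟩
  rw [Point.ell, P.isSplitting_a.plusPart_apply fun z => by ring]

/-- Summing over `k` removes the factors `1_{γ_k}`, so only projections of `ζ'` and `ℓ'` occur. As
`a_+ = z`, these are `(ζ')_+ = 1 - (â_+)'`, `(ζ')_- = a' - 1 - (â_-)'` and `(ℓ')_- = (â_-)'`. -/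
theorem component_unitField (β : Sector m) {z : ℂ} (hz : z ∈ D.contour) :
    component β P.unitField z = 1 - deriv (β.base P) z := by
  have hzI := D.contour_subset_interiorDomain hz
  have hzE := D.contour_subset_exteriorDomain hz
  have hζ := P.analyticOnNhd_zeta_contour.deriv
  have hl := P.analyticOnNhd_ell_contour.deriv
  have u1 := (isSplitting_sum_charFun hζ).unique (isSplitting_zeta (P := P)).deriv EventuallyEq.rfl
  have u2 := (isSplitting_sum_charFun hl).unique (isSplitting_ell (P := P)).deriv EventuallyEq.rfl
  have p1 := u1.1.self_of_nhdsSet hzI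
  have q1 := u1.2.self_of_nhdsSet hzE
  have q2 := u2.2.self_of_nhdsSet hzE
  have hp := (analyticOnNhd_plusPart_contour P.aHat_analytic_contour z hz).differentiableAt
  have hq := (analyticOnNhd_minusPart_contour P.aHat_analytic_contour z hz).differentiableAt
  have ha := (P.a_analytic z hzE).differentiableAt
  rw [deriv_fun_sub differentiableAt_fun_id hp, deriv_id''] at p1
  rw [deriv_fun_sub (ha.fun_sub differentiableAt_fun_id) hq,
    deriv_fun_sub ha differentiableAt_fun_id, deriv_id''] at q1
  have hd := deriv_eq_deriv_plusPart_add P.aHat_analytic_contour hz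
  cases β with
  | h l =>
    have : component (.h l) P.unitField z
        = (∑ k, D.plusPart (fun w => deriv P.zeta w * D.charFun k w) z)
          - ∑ k, D.minusPart (fun w => deriv P.ell w * D.charFun k w) z := by
      simp [component, Point.unitField, Point.flatT, Point.flatH, Prod.snd_sum,
        Finset.sum_add_distrib, sub_eq_add_neg]
    rw [this, p1, q2]
    simp only [Sector.base, hd]
    ring
  | e =>
    have : component (m := m) .e P.unitField z
        = -(∑ k, D.minusPart (fun w => deriv P.zeta w * D.charFun k w) z)
          - ∑ k, D.minusPart (fun w => deriv P.ell w * D.charFun k w) z := by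
      simp [component, Point.unitField, Point.flatT, Point.flatH, Prod.fst_sum,
        Finset.sum_add_distrib, sub_eq_add_neg]
    rw [this, q1, q2]
    simp only [Sector.base]
    ring

/-- Near `γ`, `ℓ' 1_{γ_k}` differs from `(â 1_{γ_k})'` by a function analytic on `D^int`, so both
have the same minus part, and projection commutes with differentiation. -/
theorem component_flatH (β : Sector m) (k : Fin m) {z : ℂ} (hz : z ∈ D.contour) :
    component β (P.flatH k) z = -deriv (D.minusPart (density P (.h k) 1)) z := by
  have h1 : component β (P.flatH k) z
      = -D.minusPart (fun w => deriv P.ell w * D.charFun k w) z := by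
    cases β <;> rfl
  have hF := analyticOnNhd_density P (.h k) 1
  have hχ := D.analyticOnNhd_charFun k
  set κ : ℂ → ℂ := deriv fun z => D.plusPart P.a z - D.plusPart P.aHat z with hκ
  have hs : D.IsSplitting (fun w => deriv P.ell w * D.charFun k w)
      (fun w => deriv (D.plusPart (density P (.h k) 1)) w + κ w * D.charFun k w)
      (deriv (D.minusPart (density P (.h k) 1))) := by
    have hd := (isSplitting_plusPart_minusPart hF).deriv
    refine ⟨hd.1.add (P.analyticOnNhd_plusPart_sub.deriv.mul hχ), hd.2.1, hd.2.2.1, ?_⟩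
    refine eventually_nhdsSet_iff_forall.2 fun z hz => ?_
    have hzd := P.contour_subset_diff hz
    obtain ⟨c, hc⟩ := locallyConstant_charFun (D := D) k z hz
    have hl : deriv P.ell =ᶠ[𝓝 z] fun w => deriv P.aHat w + κ w := by
      filter_upwards [(P.aHat_analytic z hzd).eventually_analyticAt,
        (P.analyticOnNhd_plusPart_sub z hzd.1).eventually_analyticAt] with w h1 h2
      rw [P.ell_eq_interior, deriv_fun_add h1.differentiableAt h2.differentiableAt]
    have hD : deriv (density P (.h k) 1) =ᶠ[𝓝 z] fun w => deriv P.aHat w * c := by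
      have h3 : density P (.h k) 1 =ᶠ[𝓝 z] fun w => P.aHat w * c := by
        filter_upwards [hc] with w hw
        simp [density, hw]
      refine h3.deriv.trans (Eventually.of_forall fun w => ?_)
      exact deriv_mul_const_field c
    filter_upwards [hl, hD, hc,
      eventually_nhdsSet_iff_forall.1 hd.2.2.2 z hz] with w h1 h2 h3 h4
    rw [h1, h3]
    rw [h2] at h4
    linear_combination h4
  rw [h1, hs.minusPart_eq.self_of_nhdsSet (D.contour_subset_exteriorDomain hz)]

/-- For `h_{k,0}` this is one integration by parts. For `e`, the term `-b'` of `∂_e b` contributes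
an exact integrand, and the term `1` leaves the integral of the density. -/
theorem Omega_zero_eq (α β : Sector m) (q : ℕ) :
    D.totalInt (fun z => density P β (q + 1) z * component β (flatField P α) z)
      = Omega α 0 β q P := by
  have hG := analyticOnNhd_density P β (q + 1)
  cases α with
  | h k =>
    have hF := analyticOnNhd_density P (.h k) 1
    rw [Omega_h]
    refine (isNull_deriv_mul_add (analyticOnNhd_minusPart_contour hF) hG).neg.totalInt_eq
      (continuousOn_minusPart_mul_deriv hF hG) fun z hz => ?_
    simp only [flatField, component_flatH β k hz]
    ring
  | e =>
    rw [Omega_e_zero]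
    refine (isNull_density_mul_deriv P (β := β) (q + 1)).neg.totalInt_eq hG.continuousOn fun z hz => ?_
    simp only [flatField, component_unitField β hz]
    ring

end FlatFields

end Whitham

theorem theorem3p1 {m : ℕ} (D : Whitham.DiskConfig m) :
    Whitham.IsTauStructure (D := D) Whitham.theta Whitham.Omega where
  exists_gradient α p P := ⟨_, Whitham.isGradient_gradTheta α p⟩
  recursion α p β q P Y Z hY hZ := by
    rw [Whitham.shiftedOmega_eq, Whitham.metric_isGradient_eq hY hZ,
      ← Whitham.shiftedOmega_eq β q α p]
    -- The index lowered in the first term belongs to `α`, whereas `shiftedOmega` lowers the second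
    -- pair; symmetry exchanges the pairs.
    simp only [Whitham.Omega_symm α (p - 1)]
  symm α p β q P := Whitham.Omega_symm α p β q
  unit α p P := by
    rw [Whitham.Omega_symm, Whitham.Omega_e_zero, Whitham.theta_eq]
  initial α β q P := by
    rw [← Whitham.Omega_zero_eq]
    exact P.hasDirDeriv_theta (Whitham.isTangent_flatField α) β (q + 1)
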